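/- For $\tau$ in the upper half-plane $\mathbb H$ let $q=e^{2\pi i\tau}$, $E_2(\tau)=1-24\sum_{n\ge1}\sigma_1(n)q^n$, $$F_2(\tau)=\frac{4E_2(4\tau)-E_2(\tau)}{3},\qquad G_2(\tau)=4E_2(4\tau)-4E_2(2\tau)+E_2(\tau),$$ $$J_4=\frac{F_2^2}{F_2^2-G_2^2},\qquad P_2^*(\tau)=E_2(2\tau)-\frac{3}{2\pi\,\mathrm{Im}\,\tau},$$ and let $R_n(d)=\prod_{1\le i\le d,\ \gcd(i,d)=1}\frac{(i/d)_n}{n!}$, where $(x)_n=x(x+1)\cdots(x+n-1)$; thus $R_n(2)=(1/2)_n/n!$. Let $U$ be the connected component containing $\tau=i$ of the set $\{\tau\in\mathbb H: |J_4(\tau)|>1\}$, and let $\overline U$ be its closure in $\mathbb H$. Then $U$ contains every $\tau$ with $\mathrm{Im}\,\tau\ge1$, and the following hold. (1) For every $\tau\in\overline U$ one has $F_2(\tau)\neq0$, $F_2(\tau)^2\ne G_2(\tau)^2$, and $$F_2(\tau)={}_3F_2\left(\tfrac12,\tfrac12,\tfrac12;1,1;\frac1{J_4(\tau)}\right)=\sum_{n\ge0}\frac{(1/2)_n^3}{(1)_n^2\,n!}\,\frac1{J_4(\tau)^n},$$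 where the series converges absolutely. (2) For every $\tau\in\overline U$ with $J_4(\tau)\ne1$ one has $G_2(\tau)\ne0$ and $$\sum_{n\ge0}\left(3n+1-\frac{P_2^*(\tau)}{G_2(\tau)}\right)\frac{R_n(2)^3}{J_4(\tau)^n}=\frac{3}{2\pi\,\mathrm{Im}\,\tau}\,\frac{F_2(\tau)}{G_2(\tau)},$$ where the series converges absolutely if $\tau\in U$ and, in general, as the limit of its partial sums. -/

import Mathlib

open scoped UpperHalfPlane

noncomputable section

namespace RamanujanLevelFour

/-- The point `N τ` of the upper half-plane, for a positive integer `N`. -/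
def scale (N : ℕ) [NeZero N] (τ : ℍ) : ℍ :=
  UpperHalfPlane.mk ((N : ℂ) * (τ : ℂ)) (by
    have h : (0 : ℝ) < (N : ℝ) := Nat.cast_pos.mpr (Nat.pos_of_ne_zero (NeZero.ne N))
    simpa using mul_pos h τ.im_pos)

/-- `F₂(τ) = (4 E₂(4τ) - E₂(τ)) / 3`. -/
def F2 (τ : ℍ) : ℂ :=
  (4 * EisensteinSeries.E2 (scale 4 τ) - EisensteinSeries.E2 τ) / 3

/-- `G₂(τ) = 4 E₂(4τ) - 4 E₂(2τ) + E₂(τ)`. -/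
def G2 (τ : ℍ) : ℂ :=
  4 * EisensteinSeries.E2 (scale 4 τ) - 4 * EisensteinSeries.E2 (scale 2 τ)
    + EisensteinSeries.E2 τ

/-- `J₄ = F₂² / (F₂² - G₂²)`. -/
def J4 (τ : ℍ) : ℂ :=
  F2 τ ^ 2 / (F2 τ ^ 2 - G2 τ ^ 2)

/-- `P₂*(τ) = E₂(2τ) - 3 / (2 π Im τ)`. -/
def P2star (τ : ℍ) : ℂ :=
  EisensteinSeries.E2 (scale 2 τ) - 3 / (2 * (Real.pi : ℂ) * (τ.im : ℂ))

/-- The Pochhammer symbol `(x)_n = x (x + 1) ⋯ (x + n - 1)`. -/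
def poch (x : ℂ) (n : ℕ) : ℂ := (ascPochhammer ℂ n).eval x

/-- `R_n(d) = ∏_{1 ≤ i ≤ d, gcd(i, d) = 1} (i/d)_n / n!`. -/
def R (n d : ℕ) : ℂ :=
  ∏ i ∈ (Finset.Icc 1 d).filter (fun i => Nat.gcd i d = 1),
    poch ((i : ℂ) / (d : ℂ)) n / (n.factorial : ℂ)

/-- The `n`-th term of the series `₃F₂(a, b, c; d, e; x)`. -/
def hyp32Term (a b c d e x : ℂ) (n : ℕ) : ℂ :=
  poch a n * poch b n * poch c n / (poch d n * poch e n * (n.factorial : ℂ)) * x ^ n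

/-- The connected component containing `i` of the set of `τ` with `|J₄(τ)| > 1`. -/
def cuspDomain : Set ℍ :=
  connectedComponentIn {τ : ℍ | 1 < ‖J4 τ‖} UpperHalfPlane.I

/-- The `n`-th term of the series for `1 / π` at `τ`. -/
def piTerm (τ : ℍ) (n : ℕ) : ℂ :=
  (3 * (n : ℂ) + 1 - P2star τ / G2 τ) * (R n 2 ^ 3 / J4 τ ^ n)

end RamanujanLevelFour

end

open scoped MatrixGroups ModularForm Manifold Derivative Topology
open UpperHalfPlane Filter EisensteinSeries

noncomputable section

namespace RamanujanLevelFour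

/-! Three weight two forms `e1`, `e2`, `e3` are permuted by S and T. Comparison with level one (no
cusp forms below weight 12, only multiples of Δ in weight 12) gives their sum and differential
equations (`e1_add_e2_add_e3`, `defects_eq_zero`), and with `D_E2` a closed system. Evaluated at 2τ,
it becomes a system for F₂, G₂ and P₂ = E₂(2τ), in which D F₂ = F₂(P₂ - G₂)/3 and, for x = 1/J₄, D x
= G₂ x. The differences of the eᵢ solve first order linear equations, so they have no zeros; hence
F₂ and F₂² - G₂² have none.

Since D x = G₂ x, the operator x d/dx acting on the series becomes G₂⁻¹ D where G₂ ≠ 0. The third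
order hypergeometric equation then says exactly that the third τ-derivative of ₃F₂(x)/F₂ is 0
(`hasDerivAt_numer₂`). The ratio is thus a quadratic polynomial in τ for Im τ > 1; it has period 1
and tends to 1 at the cusp, so it equals 1. The identity theorem carries this to U and continuity to
its closure.

Differentiating the identity once evaluates G₂ ∑ n aₙ xⁿ through P₂ (`G2_mul_hyp_one`); the 1/π term
enters only through the definition of P₂*. On the boundary the coefficients n aₙ are no longer
summable, but those of (1 - x) ∑ n aₙ xⁿ are, so that product extends continuously, and summation by
parts recovers the limit of the partial sums for x ≠ 1. -/

/-! ### Level one forms that vanish -/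

/-- A holomorphic function on `ℍ`, invariant under `S` and `T` in weight `k` and vanishing
at `i∞`, as a cusp form. -/
def cuspFormOfGenerators {k : ℤ} (f : ℍ → ℂ) (hf : MDiff f)
    (hS : f ∣[k] ModularGroup.S = f) (hT : f ∣[k] ModularGroup.T = f)
    (h0 : IsZeroAtImInfty f) : CuspForm 𝒮ℒ k where
  toFun := f
  slash_action_eq' A hA := by
    obtain ⟨A, rfl⟩ := hA
    exact SlashInvariantForm.slash_action_generators_SL2Z hS hT A
  holo' := hf
  zero_at_cusps' {c} hc := by
    rw [Subgroup.IsArithmetic.isCusp_iff_isCusp_SL2Z] at hc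
    rw [OnePoint.isZeroAt_iff_forall_SL2Z hc]
    intro γ _
    have := SlashInvariantForm.slash_action_generators_SL2Z hS hT γ
    simpa [this] using h0

theorem eq_zero_of_weight_lt_twelve {k : ℤ} (hk : k < 12) {f : ℍ → ℂ} (hf : MDiff f)
    (hS : f ∣[k] ModularGroup.S = f) (hT : f ∣[k] ModularGroup.T = f)
    (h0 : IsZeroAtImInfty f) : f = 0 := by
  have h := rank_zero_iff_forall_zero.mp (CuspForm.rank_eq_zero_of_weight_lt_twelve hk)
    (cuspFormOfGenerators f hf hS hT h0)
  exact congrArg (fun g : CuspForm 𝒮ℒ k => (g : ℍ → ℂ)) h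

/-- A cusp form of weight 12 is a multiple of Δ, and Δ decays no faster than exp(-2π Im τ), so the
assumed decay forces the multiple to be 0. -/
theorem eq_zero_of_weight_twelve {f : ℍ → ℂ} (hf : MDiff f)
    (hS : f ∣[(12 : ℤ)] ModularGroup.S = f) (hT : f ∣[(12 : ℤ)] ModularGroup.T = f)
    (h0 : f =O[atImInfty] fun τ => Real.exp (-3 * Real.pi * τ.im)) : f = 0 := by
  have hexp : ∀ {c : ℝ}, c < 0 → Tendsto (fun τ : ℍ => Real.exp (c * τ.im)) atImInfty (𝓝 0) := by
    intro c hc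
    exact Real.tendsto_exp_atBot.comp
      (tendsto_comap.const_mul_atTop_of_neg hc)
  have hz : IsZeroAtImInfty f :=
    h0.trans_tendsto (hexp (by nlinarith [Real.pi_pos]))
  obtain ⟨c, hc⟩ := CuspForm.exists_smul_discriminant_of_weight_eq_twelve
    (cuspFormOfGenerators f hf hS hT hz)
  have hfc : ∀ z, f z = c * ModularForm.discriminant z := by
    intro z
    exact (congrArg (fun g : CuspForm 𝒮ℒ 12 => g z) hc).symm
  by_cases hc0 : c = 0
  · ext z
    simp [hfc, hc0]
  · exfalso
    have h1 : ModularForm.discriminant =O[atImInfty] f := by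
      refine Asymptotics.IsBigO.of_bound ‖c⁻¹‖ (Eventually.of_forall fun z => ?_)
      rw [hfc, ← norm_mul, inv_mul_cancel_left₀ hc0]
    have h2 : (fun τ : ℍ => Real.exp (-2 * Real.pi * τ.im)) =O[atImInfty]
        fun τ : ℍ => Real.exp (-3 * Real.pi * τ.im) :=
      (ModularForm.exp_isBigO_discriminant.trans h1).trans h0
    have h3 : (fun τ : ℍ => Real.exp (-3 * Real.pi * τ.im)) =o[atImInfty]
        fun τ : ℍ => Real.exp (-2 * Real.pi * τ.im) := by
      rw [Asymptotics.isLittleO_iff_tendsto (fun x hx => absurd hx (Real.exp_ne_zero _))]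
      refine (hexp (c := -Real.pi) (by linarith [Real.pi_pos])).congr fun τ => ?_
      rw [← Real.exp_sub]
      ring_nf
    have h4 := h2.trans_isLittleO h3
    have h5 := Asymptotics.isLittleO_irrefl (f'' := fun τ : ℍ => Real.exp (-2 * Real.pi * τ.im))
      (l := atImInfty) (Eventually.frequently (Eventually.of_forall fun x => Real.exp_ne_zero _))
    exact h5 h4

/-! ### Behaviour of `E₂` -/

theorem riemannZeta_two_inv_coeff :
    1 / (2 * riemannZeta 2) * (2 * Real.pi * Complex.I) = -(6 / (Real.pi * Complex.I)) := by
  rw [riemannZeta_two]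
  have : (Real.pi : ℂ) ≠ 0 := by exact_mod_cast Real.pi_ne_zero
  field_simp
  rw [Complex.I_sq]

/-- The transformation law of `E₂`, for points related by an integral matrix of determinant one. -/
theorem E2_of_moebius (a b c d : ℤ) (hdet : a * d - b * c = 1) (τ τ' : ℍ)
    (h : (τ' : ℂ) * (c * τ + d) = a * τ + b) :
    E2 τ' = (c * τ + d) ^ 2 * E2 τ + 6 / (Real.pi * Complex.I) * c * (c * τ + d) := by
  let γ : SL(2, ℤ) := ⟨!![a, b; c, d], by rw [Matrix.det_fin_two_of]; exact hdet⟩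
  have hd : denom γ τ = c * τ + d := by
    rw [ModularGroup.denom_apply]
    simp [γ]
  have hd0 : (c * τ + d : ℂ) ≠ 0 := hd ▸ denom_ne_zero γ τ
  have hτ : γ • τ = τ' := by
    apply UpperHalfPlane.ext
    rw [UpperHalfPlane.specialLinearGroup_apply]
    simp [γ]
    rw [div_eq_iff hd0, h]
  have h1 := congrFun (E2_slash_action γ) τ
  rw [ModularForm.SL_slash_apply, hτ, hd] at h1
  simp only [Pi.sub_apply, Pi.smul_apply, D2, hd, smul_eq_mul] at h1
  have h2 : (γ 1 0 : ℂ) = c := by simp [γ]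
  rw [h2] at h1
  have h3 := riemannZeta_two_inv_coeff
  rw [zpow_neg, ← div_eq_mul_inv, div_eq_iff (zpow_ne_zero _ hd0)] at h1
  rw [h1]
  rw [show (1 / (2 * riemannZeta 2) * (2 * Real.pi * Complex.I * c / (c * τ + d)) : ℂ)
    = 1 / (2 * riemannZeta 2) * (2 * Real.pi * Complex.I) * c / (c * τ + d) by ring, h3]
  rw [show ((2 : ℤ)) = ((2 : ℕ) : ℤ) by rfl, zpow_natCast]
  field_simp
  ring

theorem sigma_one_le_sq (n : ℕ) : ArithmeticFunction.sigma 1 n ≤ n * n := by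
  rw [ArithmeticFunction.sigma_one_apply]
  calc ∑ d ∈ n.divisors, d ≤ ∑ d ∈ n.divisors, n := Finset.sum_le_sum fun d hd =>
        Nat.divisor_le hd
    _ = n.divisors.card * n := by simp
    _ ≤ n * n := Nat.mul_le_mul_right _ (Nat.card_divisors_le_self n)

theorem norm_cexp_two_pi_I_mul (z : ℍ) :
    ‖Complex.exp (2 * Real.pi * Complex.I * z)‖ = Real.exp (-2 * Real.pi * z.im) := by
  rw [Complex.norm_exp]
  congr 1
  simp

/-- An explicit bound for the distance of `E₂` to its value at the cusp. -/
theorem norm_E2_sub_one_le (z : ℍ) :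
    ‖E2 z - 1‖ ≤ 48 * Real.exp (-2 * Real.pi * z.im) /
      (1 - Real.exp (-2 * Real.pi * z.im)) ^ 3 := by
  set r := Real.exp (-2 * Real.pi * z.im) with hr
  have hr0 : 0 ≤ r := (Real.exp_pos _).le
  have hr1 : r < 1 := by
    rw [hr, Real.exp_lt_one_iff]
    nlinarith [Real.pi_pos, z.im_pos, mul_pos Real.pi_pos z.im_pos]
  have hnr : ‖r‖ < 1 := by rwa [Real.norm_of_nonneg hr0]
  have h0 := (hasSum_nat_add_iff' 1).mpr (hasSum_qExpansion_E2 z)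
  simp only [Finset.range_one, Finset.sum_singleton, if_true, pow_zero,
    Nat.add_eq_zero_iff, one_ne_zero, and_false, if_false, smul_eq_mul, mul_one] at h0
  have hs : Summable fun n : ℕ => ((n + 2).choose 2 : ℝ) * r ^ n :=
    summable_choose_mul_geometric_of_norm_lt_one 2 hnr
  have ht := tsum_choose_mul_geometric_of_norm_lt_one 2 hnr
  have hsum : HasSum (fun n : ℕ => 48 * r * (((n + 2).choose 2 : ℝ) * r ^ n))
      (48 * r * (1 / (1 - r) ^ 3)) := by
    have := hs.hasSum
    rw [ht] at this
    exact this.mul_left _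
  rw [← h0.tsum_eq, mul_div_assoc, ← mul_one_div, ← mul_assoc]
  refine tsum_of_norm_bounded (by simpa using hsum) fun n => ?_
  rw [norm_mul, norm_pow, norm_cexp_two_pi_I_mul, ← hr, pow_succ]
  -- 24 σ₁(n+1) ≤ 24 (n+1)² ≤ 24 (n+2)(n+1), and the last is 48 times the binomial coefficient,
  -- whose generating series is (1 - r)⁻³.
  have h1 : ‖(-24 * (ArithmeticFunction.sigma 1 (n + 1) : ℂ))‖
      ≤ 48 * ((n + 2).choose 2 : ℝ) := by
    rw [norm_mul, norm_neg, Complex.norm_natCast]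
    have h2 : ((ArithmeticFunction.sigma 1 (n + 1) : ℕ) : ℝ) ≤ (n + 1) * (n + 1) := by
      exact_mod_cast sigma_one_le_sq (n + 1)
    have h3 : ((n + 2).choose 2 : ℝ) = (n + 2) * (n + 1) / 2 := by
      rw [Nat.cast_choose_two]
      push_cast
      ring
    rw [h3]
    norm_num
    nlinarith
  calc _ ≤ 48 * ((n + 2).choose 2 : ℝ) * (r ^ n * r) := by gcongr
    _ = _ := by ring

theorem tendsto_exp_neg_im : Tendsto (fun z : ℍ => Real.exp (-2 * Real.pi * z.im))
    atImInfty (𝓝 0) :=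
  Real.tendsto_exp_atBot.comp
    (tendsto_comap.const_mul_atTop_of_neg (by linarith [Real.pi_pos]))

theorem tendsto_E2 : Tendsto E2 atImInfty (𝓝 1) := by
  rw [tendsto_iff_norm_sub_tendsto_zero]
  refine squeeze_zero (fun _ => norm_nonneg _) norm_E2_sub_one_le ?_
  have h := tendsto_exp_neg_im
  have h2 : Tendsto (fun z : ℍ => 48 * Real.exp (-2 * Real.pi * z.im) /
      (1 - Real.exp (-2 * Real.pi * z.im)) ^ 3) atImInfty (𝓝 (48 * 0 / (1 - 0) ^ 3)) :=
    (h.const_mul 48).div ((tendsto_const_nhds.sub h).pow 3) (by norm_num)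
  simpa using h2

/-! ### Affine maps of the upper half-plane -/

/-- The map `τ ↦ a τ + b`, for `a > 0`. -/
def affine (a : ℝ) (ha : 0 < a) (b : ℝ) (τ : ℍ) : ℍ :=
  ⟨a * τ + b, by simpa using mul_pos ha τ.im_pos⟩

@[simp] theorem coe_affine (a : ℝ) (ha : 0 < a) (b : ℝ) (τ : ℍ) :
    (affine a ha b τ : ℂ) = a * τ + b := rfl

theorem im_affine (a : ℝ) (ha : 0 < a) (b : ℝ) (τ : ℍ) :
    (affine a ha b τ).im = a * τ.im := by
  rw [← coe_im, coe_affine]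
  simp

theorem mdiff_comp_affine {f : ℍ → ℂ} (hf : MDiff f) (a : ℝ) (ha : 0 < a) (b : ℝ) :
    MDiff (fun τ => f (affine a ha b τ)) := by
  rw [UpperHalfPlane.mdifferentiable_iff] at hf ⊢
  have h : DifferentiableOn ℂ (fun z : ℂ => (f ∘ ofComplex) (a * z + b)) {z | 0 < z.im} := by
    refine hf.comp (f := fun z : ℂ => a * z + b) (by fun_prop) fun z hz => ?_
    simpa using mul_pos ha hz
  refine h.congr fun z hz => ?_
  simp only [Function.comp_apply]
  congr 1
  have hz' : 0 < ((a : ℂ) * z + b).im := by simpa using mul_pos ha hz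
  rw [ofComplex_apply_of_im_pos hz, ofComplex_apply_of_im_pos hz']
  rfl

theorem tendsto_affine (a : ℝ) (ha : 0 < a) (b : ℝ) :
    Tendsto (affine a ha b) atImInfty atImInfty := by
  rw [atImInfty, tendsto_comap_iff]
  refine ((tendsto_comap (f := UpperHalfPlane.im)).const_mul_atTop ha).congr fun τ => ?_
  simp [im_affine]

/-! ### The three weight two forms permuted by `SL(2, ℤ)` -/

/-- `2 E₂(2τ) - E₂(τ)`. -/
def e1 (τ : ℍ) : ℂ := 2 * E2 (affine 2 two_pos 0 τ) - E2 τ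

/-- `E₂(τ/2)/2 - E₂(τ)`. -/
def e2 (τ : ℍ) : ℂ := 1 / 2 * E2 (affine (1 / 2) one_half_pos 0 τ) - E2 τ

/-- `E₂((τ+1)/2)/2 - E₂(τ)`. -/
def e3 (τ : ℍ) : ℂ := 1 / 2 * E2 (affine (1 / 2) one_half_pos (1 / 2) τ) - E2 τ

theorem mdiff_e1 : MDiff e1 :=
  (mdifferentiable_const.mul (mdiff_comp_affine E2_mdifferentiable 2 two_pos 0)).sub
    E2_mdifferentiable

theorem mdiff_e2 : MDiff e2 :=
  (mdifferentiable_const.mul (mdiff_comp_affine E2_mdifferentiable _ one_half_pos 0)).sub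
    E2_mdifferentiable

theorem mdiff_e3 : MDiff e3 :=
  (mdifferentiable_const.mul (mdiff_comp_affine E2_mdifferentiable _ one_half_pos _)).sub
    E2_mdifferentiable

theorem tendsto_e1 : Tendsto e1 atImInfty (𝓝 1) := by
  have h := ((tendsto_E2.comp (tendsto_affine 2 two_pos 0)).const_mul 2).sub tendsto_E2
  norm_num at h
  exact h

theorem tendsto_e2 : Tendsto e2 atImInfty (𝓝 (-1 / 2)) := by
  have h := ((tendsto_E2.comp (tendsto_affine _ one_half_pos 0)).const_mul (1 / 2)).sub tendsto_E2
  norm_num at h ⊢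
  exact h

theorem tendsto_e3 : Tendsto e3 atImInfty (𝓝 (-1 / 2)) := by
  have h := ((tendsto_E2.comp (tendsto_affine _ one_half_pos (1 / 2))).const_mul
    (1 / 2)).sub tendsto_E2
  norm_num at h ⊢
  exact h

/-- The point `-1/τ`. -/
def invPt (τ : ℍ) : ℍ := ⟨(-τ : ℂ)⁻¹, τ.im_inv_neg_coe_pos⟩

theorem slash_S_eq (f : ℍ → ℂ) (k : ℤ) (τ : ℍ) :
    (f ∣[k] ModularGroup.S) τ = f (invPt τ) * (τ : ℂ) ^ (-k) :=
  SlashInvariantForm.slash_S_apply f k τ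

theorem slash_T_eq (f : ℍ → ℂ) (k : ℤ) (τ : ℍ) :
    (f ∣[k] ModularGroup.T) τ = f (affine 1 one_pos 1 τ) := by
  have h1 : ModularGroup.T • τ = affine 1 one_pos 1 τ := by
    rw [modular_T_smul]
    apply UpperHalfPlane.ext
    simp [add_comm]
  rw [ModularForm.SL_slash_apply, h1, ModularGroup.denom_apply]
  simp [ModularGroup.T]

theorem E2_invPt (τ : ℍ) :
    E2 (invPt τ) = τ ^ 2 * E2 τ + 6 / (Real.pi * Complex.I) * τ := by
  have h0 := τ.ne_zero
  have h := E2_of_moebius 0 (-1) 1 0 (by norm_num) τ (invPt τ) (by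
    simp only [invPt]
    push_cast
    field_simp
    ring)
  rw [h]
  push_cast
  ring

theorem slash_S_of_eq {f g : ℍ → ℂ} (h : ∀ τ : ℍ, f (invPt τ) = τ ^ 2 * g τ) :
    f ∣[(2 : ℤ)] ModularGroup.S = g := by
  ext τ
  have h0 := τ.ne_zero
  rw [slash_S_eq, h, zpow_neg]
  rw [show ((2 : ℤ)) = ((2 : ℕ) : ℤ) by rfl, zpow_natCast]
  field_simp

/-- Doubling -1/τ gives -1/(τ/2), and the non-modular terms of the two values of `E2` cancel. -/
theorem e1_slash_S : e1 ∣[(2 : ℤ)] ModularGroup.S = e2 := by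
  refine slash_S_of_eq fun τ => ?_
  have h0 := τ.ne_zero
  have h := E2_of_moebius 0 (-1) 1 0 (by norm_num) (affine (1 / 2) one_half_pos 0 τ)
    (affine 2 two_pos 0 (invPt τ)) (by
      simp only [invPt, coe_affine]
      push_cast
      field_simp
      ring)
  rw [e1, h, E2_invPt, e2, coe_affine]
  push_cast
  ring

theorem e2_slash_S : e2 ∣[(2 : ℤ)] ModularGroup.S = e1 := by
  refine slash_S_of_eq fun τ => ?_
  have h0 := τ.ne_zero
  have h := E2_of_moebius 0 (-1) 1 0 (by norm_num) (affine 2 two_pos 0 τ)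
    (affine (1 / 2) one_half_pos 0 (invPt τ)) (by
      simp only [invPt, coe_affine]
      push_cast
      field_simp
      ring)
  rw [e2, h, E2_invPt, e1, coe_affine]
  push_cast
  ring

theorem e3_slash_S : e3 ∣[(2 : ℤ)] ModularGroup.S = e3 := by
  refine slash_S_of_eq fun τ => ?_
  have h0 := τ.ne_zero
  -- The matrix (1, -1; 2, -1) sends (τ+1)/2 to (-1/τ+1)/2.
  have h := E2_of_moebius 1 (-1) 2 (-1) (by norm_num) (affine (1 / 2) one_half_pos (1 / 2) τ)
    (affine (1 / 2) one_half_pos (1 / 2) (invPt τ)) (by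
      simp only [invPt, coe_affine]
      push_cast
      field_simp
      ring)
  rw [e3, h, E2_invPt, e3, coe_affine]
  push_cast
  ring

theorem E2_eq_of_add_int (n : ℤ) {τ τ' : ℍ} (h : (τ' : ℂ) = τ + n) : E2 τ' = E2 τ := by
  have h := E2_of_moebius 1 n 0 1 (by norm_num) τ τ' (by push_cast; rw [h]; ring)
  simpa using h

theorem e1_slash_T : e1 ∣[(2 : ℤ)] ModularGroup.T = e1 := by
  ext τ
  rw [slash_T_eq, e1, e1, E2_eq_of_add_int 1 (τ := τ) (τ' := affine 1 one_pos 1 τ) (by simp),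
    E2_eq_of_add_int 2 (τ := affine 2 two_pos 0 τ) (by simp; ring)]

theorem e2_slash_T : e2 ∣[(2 : ℤ)] ModularGroup.T = e3 := by
  ext τ
  rw [slash_T_eq, e2, e3, E2_eq_of_add_int 1 (τ := τ) (τ' := affine 1 one_pos 1 τ) (by simp),
    E2_eq_of_add_int 0 (τ := affine (1 / 2) one_half_pos (1 / 2) τ) (by simp; ring)]

theorem e3_slash_T : e3 ∣[(2 : ℤ)] ModularGroup.T = e2 := by
  ext τ
  rw [slash_T_eq, e3, e2, E2_eq_of_add_int 1 (τ := τ) (τ' := affine 1 one_pos 1 τ) (by simp),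
    E2_eq_of_add_int 1 (τ := affine (1 / 2) one_half_pos 0 τ) (by simp; ring)]

/-- S and T permute the summands, and the values at the cusp satisfy 1 - 1/2 - 1/2 = 0. -/
theorem e1_add_e2_add_e3 : e1 + e2 + e3 = 0 := by
  refine eq_zero_of_weight_lt_twelve (k := 2) (by norm_num)
    ((mdiff_e1.add mdiff_e2).add mdiff_e3) ?_ ?_ ?_
  · rw [SlashAction.add_slash, SlashAction.add_slash, e1_slash_S, e2_slash_S, e3_slash_S,
      add_comm e2]
  · rw [SlashAction.add_slash, SlashAction.add_slash, e1_slash_T, e2_slash_T, e3_slash_T,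
      add_right_comm]
  · have h := (tendsto_e1.add tendsto_e2).add tendsto_e3
    norm_num at h
    exact h

theorem e3_eq (τ : ℍ) : e3 τ = -(e1 τ + e2 τ) :=
  eq_neg_of_add_eq_zero_right (congrFun e1_add_e2_add_e3 τ)

/-! ### Derivatives at the cusp -/

/-- Cauchy's estimate for f - L on the unit disc around z. -/
theorem D_tendsto_zero {f : ℍ → ℂ} (hf : MDiff f) {L : ℂ} (hL : Tendsto f atImInfty (𝓝 L)) :
    Tendsto (D f) atImInfty (𝓝 0) := by
  have hpi : ‖(2 * Real.pi * Complex.I : ℂ)⁻¹‖ ≤ 1 := by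
    rw [norm_inv]
    refine inv_le_one_of_one_le₀ ?_
    simp [abs_of_pos Real.pi_pos]
    linarith [Real.pi_gt_three]
  rw [Metric.tendsto_nhds]
  intro ε hε
  have hL' := (Metric.tendsto_nhds.mp hL (ε / 2) (half_pos hε))
  rw [Filter.Eventually, atImInfty_mem] at hL' ⊢
  obtain ⟨A, hA⟩ := hL'
  refine ⟨max A 0 + 2, fun z hz => ?_⟩
  have hz1 : A + 2 ≤ z.im := le_trans (by gcongr; exact le_max_left _ _) hz
  have hz2 : 2 ≤ z.im := le_trans (by linarith [le_max_right A 0]) hz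
  have him : ∀ w ∈ Metric.closedBall (z : ℂ) 1, z.im - 1 ≤ w.im := by
    intro w hw
    rw [mem_closedBall_iff_norm] at hw
    have := (abs_le.mp ((Complex.abs_im_le_norm (w - z)).trans hw)).1
    simp only [Complex.sub_im, coe_im] at this
    linarith
  have hd : DifferentiableOn ℂ (fun w => (f ∘ ofComplex) w - L) (Metric.closedBall (z : ℂ) 1) := by
    refine DifferentiableOn.sub_const (c := L)
      ((UpperHalfPlane.mdifferentiable_iff.mp hf).mono fun w hw => ?_)
    have := him w hw
    show 0 < w.im
    linarith
  have hb : ‖deriv (fun w => (f ∘ ofComplex) w - L) z‖ ≤ (ε / 2) / 1 := by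
    refine Complex.norm_deriv_le_of_forall_mem_sphere_norm_le one_pos
      (hd.diffContOnCl_ball (subset_refl _)) fun w hw => ?_
    have h1 := him w (Metric.sphere_subset_closedBall hw)
    have h2 : 0 < w.im := by linarith
    have h3 := hA ⟨w, h2⟩ (by change A ≤ w.im; linarith)
    rw [Function.comp_apply, ofComplex_apply_of_im_pos h2]
    rw [← dist_eq_norm]
    exact le_of_lt h3
  rw [deriv_sub_const] at hb
  show dist (D f z) 0 < ε
  rw [dist_zero_right, Derivative.normalizedDerivOfComplex, norm_mul]
  calc _ ≤ 1 * (ε / 2 / 1) := by gcongr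
    _ < ε := by linarith

theorem slash_T_sq_periodic {f : ℍ → ℂ} {k : ℤ}
    (h : (f ∣[k] ModularGroup.T) ∣[k] ModularGroup.T = f) :
    Function.Periodic (f ∘ ofComplex) ((2 : ℝ) : ℂ) := by
  intro w
  by_cases hw : 0 < w.im
  · have hw2 : 0 < (w + ((2 : ℝ) : ℂ)).im := by simpa using hw
    rw [Function.comp_apply, Function.comp_apply, ofComplex_apply_of_im_pos hw,
      ofComplex_apply_of_im_pos hw2]
    have h1 := congrFun h ⟨w, hw⟩
    rw [slash_T_eq, slash_T_eq] at h1
    rw [← h1]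
    congr 1
    apply UpperHalfPlane.ext
    simp only [coe_affine]
    push_cast
    ring
  -- Off the upper half-plane `ofComplex` is constant.
  · have hw2 : ¬ 0 < (w + ((2 : ℝ) : ℂ)).im := by simpa using hw
    rw [Function.comp_apply, Function.comp_apply,
      ofComplex_apply_of_im_nonpos (not_lt.mp hw), ofComplex_apply_of_im_nonpos (not_lt.mp hw2)]

/-! ### The differential system -/

/-- `e₁² + e₂² + e₃²`. -/
def sumSq : ℍ → ℂ := e1 * e1 + e2 * e2 + e3 * e3

theorem mdiff_sumSq : MDiff sumSq :=
  ((mdiff_e1.mul mdiff_e1).add (mdiff_e2.mul mdiff_e2)).add (mdiff_e3.mul mdiff_e3)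

theorem tendsto_sumSq : Tendsto sumSq atImInfty (𝓝 (3 / 2)) := by
  have h := ((tendsto_e1.mul tendsto_e1).add (tendsto_e2.mul tendsto_e2)).add
    (tendsto_e3.mul tendsto_e3)
  norm_num at h
  exact h

theorem sumSq_slash_S : sumSq ∣[(2 + 2 : ℤ)] ModularGroup.S = sumSq := by
  simp only [sumSq, SlashAction.add_slash, ModularForm.mul_slash_SL2, e1_slash_S, e2_slash_S,
    e3_slash_S]
  ring

theorem sumSq_slash_T : sumSq ∣[(2 + 2 : ℤ)] ModularGroup.T = sumSq := by
  simp only [sumSq, SlashAction.add_slash, ModularForm.mul_slash_SL2, e1_slash_T, e2_slash_T,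
    e3_slash_T]
  ring

/-- The defect in the differential equation satisfied by the forms `eᵢ`. -/
def defect (f : ℍ → ℂ) : ℍ → ℂ :=
  Derivative.serreDerivative ((2 : ℤ) : ℂ) f + (1 / 3 : ℂ) • (f * f) + (-1 / 9 : ℂ) • sumSq

theorem mdiff_defect {f : ℍ → ℂ} (hf : MDiff f) : MDiff (defect f) :=
  ((Derivative.serreDerivative_mdifferentiable _ hf).add ((hf.mul hf).const_smul _)).add
    (mdiff_sumSq.const_smul _)

theorem defect_slash {f g : ℍ → ℂ} (hf : MDiff f) {γ : SL(2, ℤ)} (h : f ∣[(2 : ℤ)] γ = g)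
    (hs : sumSq ∣[(2 + 2 : ℤ)] γ = sumSq) : defect f ∣[(2 + 2 : ℤ)] γ = defect g := by
  simp only [defect, SlashAction.add_slash, ModularForm.SL_smul_slash, ModularForm.mul_slash_SL2,
    Derivative.serreDerivative_slash_equivariant hf, h, hs]

/-- The limit is (2L + 1)(L - 1)/6, which vanishes precisely at the cusp values -1/2 and 1 of the
eᵢ; this explains the coefficients in `defect`. -/
theorem tendsto_defect {f : ℍ → ℂ} (hf : MDiff f) {L : ℂ} (hL : Tendsto f atImInfty (𝓝 L)) :
    Tendsto (defect f) atImInfty (𝓝 (-L / 6 + L ^ 2 / 3 - 1 / 6)) := by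
  have h := (((D_tendsto_zero hf hL).sub ((tendsto_E2.const_mul (2 * 12⁻¹ : ℂ)).mul hL)).add
    ((hL.mul hL).const_mul (1 / 3 : ℂ))).add (tendsto_sumSq.const_mul (-1 / 9 : ℂ))
  convert! h using 2
  ring

theorem isBigO_of_periodic_two {f : ℍ → ℂ} (hf : MDiff f)
    (hT : (f ∣[(2 + 2 : ℤ)] ModularGroup.T) ∣[(2 + 2 : ℤ)] ModularGroup.T = f)
    (h0 : Tendsto f atImInfty (𝓝 0)) :
    f =O[atImInfty] fun τ => Real.exp (-Real.pi * τ.im) := by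
  have h := IsZeroAtImInfty.exp_decay_atImInfty (h := 2) h0 two_pos (slash_T_sq_periodic hT) hf
    (IsZeroAtImInfty.isBoundedAtImInfty h0)
  convert! h using 3
  ring

theorem eq_zero_or_eq_zero_of_mul {f g : ℍ → ℂ} (hf : MDiff f) (hg : MDiff g)
    (h : f * g = 0) : f = 0 ∨ g = 0 := by
  have key : ∀ {f : ℍ → ℂ}, (∀ z ∈ {z : ℂ | 0 < z.im}, (f ∘ ofComplex) z = 0) → f = 0 := by
    intro f hf
    ext z
    simpa [ofComplex_apply] using hf z z.im_pos
  have hconv : IsPreconnected {z : ℂ | 0 < z.im} := (convex_halfSpace_im_gt 0).isPreconnected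
  rcases AnalyticOnNhd.eq_zero_or_eq_zero_of_mul_eq_zero
    ((UpperHalfPlane.mdifferentiable_iff.mp hf).analyticOnNhd isOpen_upperHalfPlaneSet)
    ((UpperHalfPlane.mdifferentiable_iff.mp hg).analyticOnNhd isOpen_upperHalfPlaneSet)
    (fun z _ => congrFun h (ofComplex z)) hconv with h | h
  · exact Or.inl (key h)
  · exact Or.inr (key h)

/-- The defects are permuted by S and T, so their product has level one and weight 12. Each has
period 2 and vanishes at the cusp, hence decays like exp(-π Im τ); the product decays too fast to be
a nonzero multiple of Δ. So one factor vanishes, and the permutation carries this to the others. -/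
theorem defects_eq_zero : defect e1 = 0 ∧ defect e2 = 0 ∧ defect e3 = 0 := by
  have hS1 := defect_slash mdiff_e1 e1_slash_S sumSq_slash_S
  have hS2 := defect_slash mdiff_e2 e2_slash_S sumSq_slash_S
  have hS3 := defect_slash mdiff_e3 e3_slash_S sumSq_slash_S
  have hT1 := defect_slash mdiff_e1 e1_slash_T sumSq_slash_T
  have hT2 := defect_slash mdiff_e2 e2_slash_T sumSq_slash_T
  have hT3 := defect_slash mdiff_e3 e3_slash_T sumSq_slash_T
  have m1 := mdiff_defect mdiff_e1
  have m2 := mdiff_defect mdiff_e2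
  have m3 := mdiff_defect mdiff_e3
  have z1 : Tendsto (defect e1) atImInfty (𝓝 0) := by
    convert! tendsto_defect mdiff_e1 tendsto_e1 using 2; norm_num
  have z2 : Tendsto (defect e2) atImInfty (𝓝 0) := by
    convert! tendsto_defect mdiff_e2 tendsto_e2 using 2; norm_num
  have z3 : Tendsto (defect e3) atImInfty (𝓝 0) := by
    convert! tendsto_defect mdiff_e3 tendsto_e3 using 2; norm_num
  have o1 := isBigO_of_periodic_two m1 (by rw [hT1, hT1]) z1
  have o2 := isBigO_of_periodic_two m2 (by rw [hT2, hT3]) z2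
  have o3 := isBigO_of_periodic_two m3 (by rw [hT3, hT2]) z3
  have hprod : defect e1 * (defect e2 * defect e3) = 0 := by
    refine eq_zero_of_weight_twelve (m1.mul (m2.mul m3)) ?_ ?_ ?_
    · change _ ∣[((2 + 2) + ((2 + 2) + (2 + 2)) : ℤ)] _ = _
      rw [ModularForm.mul_slash_SL2, ModularForm.mul_slash_SL2, hS1, hS2, hS3]
      ring
    · change _ ∣[((2 + 2) + ((2 + 2) + (2 + 2)) : ℤ)] _ = _
      rw [ModularForm.mul_slash_SL2, ModularForm.mul_slash_SL2, hT1, hT2, hT3]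
      ring
    · refine (o1.mul (o2.mul o3)).congr_right fun τ => ?_
      rw [← Real.exp_add, ← Real.exp_add]
      ring_nf
  have h12 : defect e1 = 0 ↔ defect e2 = 0 := by
    rw [← hS1, SlashAction.slash_eq_zero_iff]
  have h23 : defect e2 = 0 ↔ defect e3 = 0 := by
    rw [← hT2, SlashAction.slash_eq_zero_iff]
  have : defect e1 = 0 := by
    rcases eq_zero_or_eq_zero_of_mul m1 (m2.mul m3) hprod with h | h
    · exact h
    · rcases eq_zero_or_eq_zero_of_mul m2 m3 h with h | h
      · exact h12.mpr h
      · exact h12.mpr (h23.mpr h)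
  exact ⟨this, h12.mp this, h23.mp (h12.mp this)⟩

theorem D_eq_of_defect_eq_zero {f : ℍ → ℂ} (h : defect f = 0) (τ : ℍ) :
    D f τ = E2 τ * f τ / 6 - (f τ ^ 2 - sumSq τ / 3) / 3 := by
  have := congrFun h τ
  simp only [defect, Pi.add_apply, Derivative.serreDerivative_apply, Pi.smul_apply, Pi.mul_apply,
    Pi.zero_apply, smul_eq_mul] at this
  push_cast at this
  linear_combination this

theorem D_e1 (τ : ℍ) : D e1 τ = E2 τ * e1 τ / 6 - (e1 τ ^ 2 - sumSq τ / 3) / 3 :=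
  D_eq_of_defect_eq_zero defects_eq_zero.1 τ

theorem D_e2 (τ : ℍ) : D e2 τ = E2 τ * e2 τ / 6 - (e2 τ ^ 2 - sumSq τ / 3) / 3 :=
  D_eq_of_defect_eq_zero defects_eq_zero.2.1 τ

theorem D_e3 (τ : ℍ) : D e3 τ = E2 τ * e3 τ / 6 - (e3 τ ^ 2 - sumSq τ / 3) / 3 :=
  D_eq_of_defect_eq_zero defects_eq_zero.2.2 τ

/-- The function `τ ↦ 6 / (π i τ)`, which measures how far `E₂` is from being modular. -/
def correction (τ : ℍ) : ℂ := 6 / (Real.pi * Complex.I) / τ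

theorem mdiff_correction : MDiff correction := by
  rw [UpperHalfPlane.mdifferentiable_iff]
  have h : DifferentiableOn ℂ (fun z : ℂ => 6 / (Real.pi * Complex.I) / z) {z | 0 < z.im} := by
    refine (differentiableOn_const _).div differentiableOn_id fun z hz h0 => ?_
    simp [h0] at hz
  refine h.congr fun z hz => ?_
  rw [Function.comp_apply, ofComplex_apply_of_im_pos hz]
  rfl

theorem D_correction (τ : ℍ) :
    D correction τ = -(3 / (Real.pi * Complex.I) ^ 2) / τ ^ 2 := by
  have h0 := τ.ne_zero
  have hpi : (Real.pi : ℂ) ≠ 0 := by exact_mod_cast Real.pi_ne_zero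
  have h1 : HasDerivAt (fun z : ℂ => 6 / (Real.pi * Complex.I) / z)
      (6 / (Real.pi * Complex.I) * -((τ : ℂ) ^ 2)⁻¹) τ := by
    rw [show (fun z : ℂ => 6 / (Real.pi * Complex.I) / z) =
      fun z => 6 / (Real.pi * Complex.I) * z⁻¹ from funext fun z => div_eq_mul_inv _ _]
    exact (hasDerivAt_inv h0).const_mul _
  have h2 : (correction ∘ ofComplex) =ᶠ[𝓝 (τ : ℂ)] fun z : ℂ => 6 / (Real.pi * Complex.I) / z := by
    filter_upwards [isOpen_upperHalfPlaneSet.mem_nhds τ.im_pos] with z hz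
    rw [Function.comp_apply, ofComplex_apply_of_im_pos hz]
    rfl
  rw [Derivative.normalizedDerivOfComplex, (h1.congr_of_eventuallyEq h2).deriv]
  field_simp
  norm_num

theorem E2_slash_S : E2 ∣[(2 : ℤ)] ModularGroup.S = E2 + correction := by
  refine slash_S_of_eq fun τ => ?_
  have h0 := τ.ne_zero
  rw [E2_invPt, Pi.add_apply, correction]
  field_simp

theorem E2_slash_T : E2 ∣[(2 : ℤ)] ModularGroup.T = E2 := by
  ext τ
  rw [slash_T_eq, E2_eq_of_add_int 1 (τ := τ) (by simp)]

theorem D_E2_slash_S (τ : ℍ) : (D E2 ∣[(2 + 2 : ℤ)] ModularGroup.S) τ =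
    D E2 τ + D correction τ + 1 / (Real.pi * Complex.I) / τ * (E2 τ + correction τ) := by
  have h := congrFun (Derivative.normalizedDerivOfComplex_SL_slash (k := 2) E2_mdifferentiable
    (γ := ModularGroup.S)) τ
  rw [E2_slash_S, Derivative.normalizedDerivOfComplex_add _ _ E2_mdifferentiable
    mdiff_correction] at h
  simp only [Pi.add_apply, Pi.sub_apply] at h
  rw [h, ModularGroup.denom_S]
  have h0 := τ.ne_zero
  have hpi : (Real.pi : ℂ) ≠ 0 := by exact_mod_cast Real.pi_ne_zero
  simp [ModularGroup.S]
  field_simp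
  ring

theorem D_E2_slash_T : D E2 ∣[(2 + 2 : ℤ)] ModularGroup.T = D E2 := by
  ext τ
  have h := congrFun (Derivative.normalizedDerivOfComplex_SL_slash (k := 2) E2_mdifferentiable
    (γ := ModularGroup.T)) τ
  rw [E2_slash_T] at h
  rw [h]
  simp [ModularGroup.T]

/-- Ramanujan's equation, with `sumSq` in the role of (3/2) E₄. The non-modular terms of D E₂ and
E₂²/12 cancel, leaving a level one form of weight 4 that vanishes at the cusp. -/
theorem D_E2 (τ : ℍ) : D E2 τ = E2 τ ^ 2 / 12 - sumSq τ / 18 := by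
  have h : D E2 + (-1 / 12 : ℂ) • (E2 * E2) + (1 / 18 : ℂ) • sumSq = 0 := by
    refine eq_zero_of_weight_lt_twelve (k := 2 + 2) (by norm_num) ?_ ?_ ?_ ?_
    · exact ((Derivative.normalizedDerivOfComplex_mdifferentiable E2_mdifferentiable).add
        ((E2_mdifferentiable.mul E2_mdifferentiable).const_smul _)).add (mdiff_sumSq.const_smul _)
    · simp only [SlashAction.add_slash, ModularForm.SL_smul_slash, ModularForm.mul_slash_SL2,
        E2_slash_S, sumSq_slash_S]
      ext τ
      simp only [Pi.add_apply, Pi.smul_apply, Pi.mul_apply, smul_eq_mul]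
      rw [D_E2_slash_S, D_correction, correction]
      have h0 := τ.ne_zero
      have hpi : (Real.pi : ℂ) ≠ 0 := by exact_mod_cast Real.pi_ne_zero
      field_simp
      ring
    · simp only [SlashAction.add_slash, ModularForm.SL_smul_slash, ModularForm.mul_slash_SL2,
        E2_slash_T, sumSq_slash_T, D_E2_slash_T]
    · have h := ((D_tendsto_zero E2_mdifferentiable tendsto_E2).add
        ((tendsto_E2.mul tendsto_E2).const_mul (-1 / 12 : ℂ))).add
        (tendsto_sumSq.const_mul (1 / 18 : ℂ))
      have h0 : (0 + -1 / 12 * (1 * 1) + 1 / 18 * (3 / 2) : ℂ) = 0 := by norm_num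
      rw [h0] at h
      exact h
  have := congrFun h τ
  simp only [Pi.add_apply, Pi.smul_apply, Pi.mul_apply, Pi.zero_apply, smul_eq_mul] at this
  linear_combination this

/-! ### Nonvanishing -/

theorem hasDerivAt_comp_ofComplex {f : ℍ → ℂ} (hf : MDiff f) (τ : ℍ) :
    HasDerivAt (f ∘ ofComplex) (2 * Real.pi * Complex.I * D f τ) τ := by
  have h := (UpperHalfPlane.mdifferentiableAt_iff.mp (hf τ)).hasDerivAt
  rwa [Derivative.normalizedDerivOfComplex, mul_inv_cancel_left₀ Complex.two_pi_I_ne_zero]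

theorem analyticAt_comp_ofComplex {f : ℍ → ℂ} (hf : MDiff f) (τ : ℍ) :
    AnalyticAt ℂ (f ∘ ofComplex) τ :=
  (UpperHalfPlane.mdifferentiable_iff.mp hf).analyticOnNhd isOpen_upperHalfPlaneSet _ τ.im_pos

/-- A nonzero solution of a first order linear differential equation has no zeros. -/
theorem ne_zero_of_D_eq_mul {f g : ℍ → ℂ} (hf : MDiff f) (hg : MDiff g) (h : D f = f * g)
    (hf0 : f ≠ 0) (τ : ℍ) : f τ ≠ 0 := by
  intro hz
  apply hf0
  have ha := analyticAt_comp_ofComplex hf τ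
  have hb := analyticAt_comp_ofComplex hg τ
  have hd : deriv (f ∘ ofComplex) =ᶠ[𝓝 (τ : ℂ)]
      (f ∘ ofComplex) * ((fun _ => 2 * Real.pi * Complex.I) * (g ∘ ofComplex)) := by
    filter_upwards [isOpen_upperHalfPlaneSet.mem_nhds τ.im_pos] with z hz
    have := (hasDerivAt_comp_ofComplex hf ⟨z, hz⟩).deriv
    rw [h] at this
    change deriv (f ∘ ofComplex) z = _ at this
    rw [this]
    simp only [Pi.mul_apply, Function.comp_apply, ofComplex_apply_of_im_pos hz]
    ring
  -- At a zero, differentiation lowers a finite order by one, whereas f' = 2πi f g has order at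
  -- least that of f; so the order is infinite.
  have horder := ha.analyticOrderAt_deriv_add_one
  have hfz : (f ∘ ofComplex) (τ : ℂ) = 0 := by simpa [ofComplex_apply] using hz
  simp only [hfz, sub_zero] at horder
  rw [analyticOrderAt_congr hd,
    analyticOrderAt_mul ha (analyticAt_const.mul hb)] at horder
  have htop : analyticOrderAt (f ∘ ofComplex) (τ : ℂ) = ⊤ := by
    by_contra hne
    obtain ⟨n, hn⟩ := ENat.ne_top_iff_exists.mp hne
    rw [← hn] at horder
    have h1 : ((n : ℕ∞) + 1) ≤ n := by
      conv_rhs => rw [← horder]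
      gcongr
      exact le_self_add
    exact absurd h1 (by exact_mod_cast (by omega : ¬ n + 1 ≤ n))
  rw [analyticOrderAt_eq_top] at htop
  have hconv : IsPreconnected {z : ℂ | 0 < z.im} := (convex_halfSpace_im_gt 0).isPreconnected
  have := AnalyticOnNhd.eqOn_zero_of_preconnected_of_eventuallyEq_zero
    ((UpperHalfPlane.mdifferentiable_iff.mp hf).analyticOnNhd isOpen_upperHalfPlaneSet)
    hconv τ.im_pos htop
  ext z
  simpa [ofComplex_apply] using this z.im_pos

/-- Subtracting the two differential equations cancels `sumSq`, and the remainder is divisible by e₁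
- e₂. -/
theorem e1_sub_e2_ne_zero (τ : ℍ) : e1 τ - e2 τ ≠ 0 := by
  refine ne_zero_of_D_eq_mul (f := e1 - e2)
    (g := (1 / 6 : ℂ) • E2 + (1 / 3 : ℂ) • e3) (mdiff_e1.sub mdiff_e2)
    ((E2_mdifferentiable.const_smul _).add (mdiff_e3.const_smul _)) ?_ ?_ τ
  · rw [Derivative.normalizedDerivOfComplex_sub _ _ mdiff_e1 mdiff_e2]
    ext z
    simp only [Pi.sub_apply, Pi.mul_apply, Pi.add_apply, Pi.smul_apply, smul_eq_mul, D_e1, D_e2,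
      e3_eq]
    ring
  · intro h
    have h1 := tendsto_e1.sub tendsto_e2
    change Tendsto (e1 - e2) atImInfty _ at h1
    rw [h] at h1
    have h2 : (1 - -1 / 2 : ℂ) = 0 := tendsto_nhds_unique h1 tendsto_const_nhds
    norm_num at h2

theorem e1_sub_e3_ne_zero (τ : ℍ) : e1 τ - e3 τ ≠ 0 := by
  have h := e1_sub_e2_ne_zero (affine 1 one_pos 1 τ)
  rwa [← slash_T_eq e1 2, ← slash_T_eq e2 2, e1_slash_T, e2_slash_T] at h

theorem e2_sub_e3_ne_zero (τ : ℍ) : e2 τ - e3 τ ≠ 0 := by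
  have h := e1_sub_e3_ne_zero (invPt τ)
  have h1 := slash_S_eq e1 2 τ
  have h2 := slash_S_eq e3 2 τ
  rw [e1_slash_S] at h1
  rw [e3_slash_S] at h2
  rw [h1, h2, ← sub_mul]
  exact mul_ne_zero h (zpow_ne_zero _ τ.ne_zero)

/-! ### The forms `F₂`, `G₂` -/

theorem scale_two (τ : ℍ) : scale 2 τ = affine 2 two_pos 0 τ := by
  apply UpperHalfPlane.ext
  simp [scale]

theorem scale_four (τ : ℍ) : scale 4 τ = affine 2 two_pos 0 (affine 2 two_pos 0 τ) := by
  apply UpperHalfPlane.ext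
  simp [scale]
  ring

/-- `E₂(2τ)`. -/
def P2 (τ : ℍ) : ℂ := E2 (scale 2 τ)

theorem E2_half_double (τ : ℍ) :
    E2 (affine (1 / 2) one_half_pos 0 (affine 2 two_pos 0 τ)) = E2 τ :=
  E2_eq_of_add_int 0 (by simp)

/-- At 2τ the forms `e1` and `e2` involve exactly E₂(τ), E₂(2τ) and E₂(4τ). -/
theorem F2_eq (τ : ℍ) : F2 τ = 2 / 3 * (e1 (scale 2 τ) - e2 (scale 2 τ)) := by
  rw [F2, scale_four, scale_two, e1, e2, E2_half_double]
  ring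

theorem G2_eq (τ : ℍ) : G2 τ = -2 * e3 (scale 2 τ) := by
  rw [G2, e3_eq, scale_four, scale_two, e1, e2, E2_half_double]
  ring

theorem F2_ne_zero (τ : ℍ) : F2 τ ≠ 0 := by
  rw [F2_eq]
  exact mul_ne_zero (by norm_num) (e1_sub_e2_ne_zero _)

theorem F2_sq_sub_G2_sq_ne_zero (τ : ℍ) : F2 τ ^ 2 - G2 τ ^ 2 ≠ 0 := by
  have h : F2 τ ^ 2 - G2 τ ^ 2 = -16 / 9 *
      ((e2 (scale 2 τ) - e3 (scale 2 τ)) * (e1 (scale 2 τ) - e3 (scale 2 τ))) := by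
    rw [F2_eq, G2_eq, e3_eq]
    ring
  rw [h]
  exact mul_ne_zero (by norm_num)
    (mul_ne_zero (e2_sub_e3_ne_zero _) (e1_sub_e3_ne_zero _))

theorem mdiff_comp_scale_two {f : ℍ → ℂ} (hf : MDiff f) : MDiff (fun τ => f (scale 2 τ)) := by
  simp only [scale_two]
  exact mdiff_comp_affine hf _ _ _

theorem D_comp_scale_two {f : ℍ → ℂ} (hf : MDiff f) (τ : ℍ) :
    D (fun τ => f (scale 2 τ)) τ = 2 * D f (scale 2 τ) := by
  have hc : (scale 2 τ : ℂ) = 2 * τ := by simp [scale]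
  have h1 := hasDerivAt_comp_ofComplex hf (scale 2 τ)
  rw [hc] at h1
  have h2 := h1.comp (τ : ℂ) ((hasDerivAt_id (τ : ℂ)).const_mul 2)
  have h3 : ((fun τ => f (scale 2 τ)) ∘ ofComplex) =ᶠ[𝓝 (τ : ℂ)]
      (f ∘ ofComplex) ∘ fun y => 2 * id y := by
    filter_upwards [isOpen_upperHalfPlaneSet.mem_nhds τ.im_pos] with z hz
    have hz2 : 0 < (2 * z).im := by simpa using hz
    simp only [Function.comp_apply, id]
    rw [ofComplex_apply_of_im_pos hz, ofComplex_apply_of_im_pos hz2]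
    congr 1
  rw [Derivative.normalizedDerivOfComplex, (h2.congr_of_eventuallyEq h3).deriv]
  have := Complex.two_pi_I_ne_zero
  field_simp

theorem mdiff_P2 : MDiff P2 := mdiff_comp_scale_two E2_mdifferentiable

theorem mdiff_F2 : MDiff F2 := by
  have h : F2 = (2 / 3 : ℂ) • fun τ => (e1 - e2) (scale 2 τ) := funext F2_eq
  rw [h]
  exact (mdiff_comp_scale_two (mdiff_e1.sub mdiff_e2)).const_smul _

theorem mdiff_G2 : MDiff G2 := by
  have h : G2 = (-2 : ℂ) • fun τ => e3 (scale 2 τ) := funext G2_eq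
  rw [h]
  exact (mdiff_comp_scale_two mdiff_e3).const_smul _

theorem D_F2 (τ : ℍ) : D F2 τ = F2 τ * (P2 τ - G2 τ) / 3 := by
  have h : F2 = (2 / 3 : ℂ) • fun τ => (e1 - e2) (scale 2 τ) := funext F2_eq
  have hd : D F2 τ = 2 / 3 * (2 * (D e1 (scale 2 τ) - D e2 (scale 2 τ))) := by
    rw [h, Derivative.normalizedDerivOfComplex_smul _ _
      (mdiff_comp_scale_two (mdiff_e1.sub mdiff_e2)), Pi.smul_apply, smul_eq_mul,
      D_comp_scale_two (mdiff_e1.sub mdiff_e2),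
      Derivative.normalizedDerivOfComplex_sub _ _ mdiff_e1 mdiff_e2, Pi.sub_apply]
  rw [hd, D_e1, D_e2, F2_eq, G2_eq, P2, e3_eq]
  ring

theorem D_G2 (τ : ℍ) :
    D G2 τ = (2 * P2 τ * G2 τ - 3 * F2 τ ^ 2 + G2 τ ^ 2) / 6 := by
  have h : G2 = (-2 : ℂ) • fun τ => e3 (scale 2 τ) := funext G2_eq
  have hd := congrArg (fun f => D f τ) h
  simp only [Derivative.normalizedDerivOfComplex_smul _ _ (mdiff_comp_scale_two mdiff_e3),
    Pi.smul_apply, smul_eq_mul, D_comp_scale_two mdiff_e3, D_e3, sumSq, Pi.add_apply,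
    Pi.mul_apply] at hd
  rw [hd, F2_eq, G2_eq, P2, e3_eq]
  ring

theorem D_P2 (τ : ℍ) : D P2 τ = (P2 τ ^ 2 - (3 * F2 τ ^ 2 + G2 τ ^ 2) / 4) / 6 := by
  have hd : D P2 τ = 2 * D E2 (scale 2 τ) := D_comp_scale_two E2_mdifferentiable τ
  rw [hd, D_E2, F2_eq, G2_eq, P2, sumSq]
  simp only [Pi.add_apply, Pi.mul_apply, e3_eq]
  ring

/-- `1 / J₄`. -/
def invJ (τ : ℍ) : ℂ := (F2 τ ^ 2 - G2 τ ^ 2) / F2 τ ^ 2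

theorem one_div_J4 (τ : ℍ) : 1 / J4 τ = invJ τ := by
  rw [J4, invJ, one_div_div]

theorem J4_ne_zero (τ : ℍ) : J4 τ ≠ 0 :=
  div_ne_zero (pow_ne_zero _ (F2_ne_zero τ)) (F2_sq_sub_G2_sq_ne_zero τ)

theorem one_lt_norm_J4_iff (τ : ℍ) : 1 < ‖J4 τ‖ ↔ ‖invJ τ‖ < 1 := by
  rw [← one_div_J4, norm_div, norm_one, div_lt_one (norm_pos_iff.mpr (J4_ne_zero τ))]

theorem one_sub_invJ (τ : ℍ) : 1 - invJ τ = G2 τ ^ 2 / F2 τ ^ 2 := by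
  have := F2_ne_zero τ
  rw [invJ]
  field_simp
  ring

theorem mdiff_invJ : MDiff invJ :=
  ((mdiff_F2.pow 2).sub (mdiff_G2.pow 2)).div (mdiff_F2.pow 2)
    fun τ => pow_ne_zero 2 (F2_ne_zero τ)

theorem continuous_F2 : Continuous F2 := mdiff_F2.continuous
theorem continuous_G2 : Continuous G2 := mdiff_G2.continuous
theorem continuous_P2 : Continuous P2 := mdiff_P2.continuous
theorem continuous_invJ : Continuous invJ := mdiff_invJ.continuous

/-- This makes x d/dx on power series in x = 1/J₄ correspond to D up to the factor G₂. It is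
obtained by differentiating F₂² x = F₂² - G₂². -/
theorem D_invJ (τ : ℍ) : D invJ τ = G2 τ * invJ τ := by
  have hF := F2_ne_zero τ
  have h : F2 ^ 2 * invJ = F2 ^ 2 - G2 ^ 2 := by
    ext τ
    simp only [Pi.mul_apply, Pi.pow_apply, Pi.sub_apply, invJ]
    exact mul_div_cancel₀ _ (pow_ne_zero 2 (F2_ne_zero τ))
  have hd := congrFun (congrArg Derivative.normalizedDerivOfComplex h) τ
  rw [Derivative.normalizedDerivOfComplex_mul _ _ (mdiff_F2.pow 2) mdiff_invJ,
    Derivative.normalizedDerivOfComplex_sub _ _ (mdiff_F2.pow 2) (mdiff_G2.pow 2),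
    Derivative.normalizedDerivOfComplex_pow _ _ mdiff_F2,
    Derivative.normalizedDerivOfComplex_pow _ _ mdiff_G2] at hd
  simp only [Pi.mul_apply, Pi.pow_apply, Pi.sub_apply, Pi.add_apply, Pi.natCast_apply, D_F2, D_G2,
    invJ] at hd
  rw [invJ]
  field_simp at hd ⊢
  push_cast at hd
  refine mul_left_cancel₀ hF ?_
  linear_combination hd / 18

/-! ### Behaviour near the cusp -/

theorem E2_scale_add_one (τ : ℍ) (n : ℕ) [NeZero n] :
    E2 (scale n (affine 1 one_pos 1 τ)) = E2 (scale n τ) :=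
  E2_eq_of_add_int n (by simp [scale]; ring)

theorem P2_add_one (τ : ℍ) : P2 (affine 1 one_pos 1 τ) = P2 τ := E2_scale_add_one τ 2

theorem F2_add_one (τ : ℍ) : F2 (affine 1 one_pos 1 τ) = F2 τ := by
  rw [F2, F2, E2_scale_add_one τ 4,
    E2_eq_of_add_int 1 (τ := τ) (τ' := affine 1 one_pos 1 τ) (by simp)]

theorem G2_add_one (τ : ℍ) : G2 (affine 1 one_pos 1 τ) = G2 τ := by
  rw [G2, G2, E2_scale_add_one τ 4, E2_scale_add_one τ 2,
    E2_eq_of_add_int 1 (τ := τ) (τ' := affine 1 one_pos 1 τ) (by simp)]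

theorem invJ_add_one (τ : ℍ) : invJ (affine 1 one_pos 1 τ) = invJ τ := by
  rw [invJ, invJ, F2_add_one, G2_add_one]

theorem tendsto_scale_two : Tendsto (scale 2) atImInfty atImInfty :=
  (tendsto_affine 2 two_pos 0).congr fun τ => (scale_two τ).symm

theorem tendsto_F2 : Tendsto F2 atImInfty (𝓝 1) := by
  have h := ((tendsto_e1.sub tendsto_e2).comp tendsto_scale_two).const_mul (2 / 3)
  norm_num at h
  exact h.congr fun τ => (F2_eq τ).symm

theorem tendsto_G2 : Tendsto G2 atImInfty (𝓝 1) := by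
  have h := (tendsto_e3.comp tendsto_scale_two).const_mul (-2)
  norm_num at h
  exact h.congr fun τ => by rw [G2_eq]; simp

theorem tendsto_invJ : Tendsto invJ atImInfty (𝓝 0) := by
  have h := ((tendsto_F2.pow 2).sub (tendsto_G2.pow 2)).div (tendsto_F2.pow 2) (by norm_num)
  norm_num at h
  exact h

theorem norm_E2_sub_one_le_of_exp_le {z : ℍ} {r : ℝ} (hr : r ≤ 1 / 300)
    (h : Real.exp (-2 * Real.pi * z.im) ≤ r) : ‖E2 z - 1‖ ≤ 49 * r := by
  have h0 := Real.exp_pos (-2 * Real.pi * z.im)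
  refine (norm_E2_sub_one_le z).trans ?_
  rw [div_le_iff₀ (pow_pos (by linarith) 3)]
  have h1 : (48 / 49 : ℝ) ≤ (1 - Real.exp (-2 * Real.pi * z.im)) ^ 3 := by
    calc (48 / 49 : ℝ) ≤ (1 - 1 / 300) ^ 3 := by norm_num
      _ ≤ _ := pow_le_pow_left₀ (by norm_num) (by linarith) 3
  nlinarith

theorem exp_neg_two_pi_le : Real.exp (-2 * Real.pi) ≤ 1 / 300 := by
  have h1 : Real.exp (-2 * Real.pi) ≤ Real.exp (-6) :=
    Real.exp_le_exp.mpr (by linarith [Real.pi_gt_three])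
  have h2 : (300 : ℝ) ≤ Real.exp 6 := by
    have := Real.exp_one_gt_d9
    calc (300 : ℝ) ≤ 2.7 ^ 6 := by norm_num
      _ ≤ Real.exp 1 ^ 6 := pow_le_pow_left₀ (by norm_num) (by linarith) 6
      _ = Real.exp 6 := by rw [← Real.exp_nat_mul]; norm_num
  refine h1.trans ?_
  rw [Real.exp_neg, ← one_div]
  exact one_div_le_one_div_of_le (by norm_num) h2

/-- Here F₂ and G₂ are both close to 1, so (F₂ - G₂)(F₂ + G₂) is small against F₂². The main error
is E₂(τ) - 1; the values at 2τ and 4τ are governed by the square of exp(-2π). -/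
theorem norm_invJ_lt_one {τ : ℍ} (hτ : 1 ≤ τ.im) : ‖invJ τ‖ < 1 := by
  have hpi := Real.pi_pos
  have h1 : ‖E2 τ - 1‖ ≤ 49 * (1 / 300) :=
    norm_E2_sub_one_le_of_exp_le le_rfl
      ((Real.exp_le_exp.mpr (by nlinarith)).trans exp_neg_two_pi_le)
  have hsq : ∀ z : ℍ, 2 ≤ z.im → ‖E2 z - 1‖ ≤ 49 * (1 / 90000) := by
    intro z hz
    refine norm_E2_sub_one_le_of_exp_le (by norm_num) ?_
    calc _ ≤ Real.exp (-2 * Real.pi + -2 * Real.pi) := Real.exp_le_exp.mpr (by nlinarith)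
      _ = Real.exp (-2 * Real.pi) * Real.exp (-2 * Real.pi) := Real.exp_add _ _
      _ ≤ 1 / 300 * (1 / 300) := by gcongr <;> exact exp_neg_two_pi_le
      _ = _ := by norm_num
  have h2 : ‖E2 (scale 2 τ) - 1‖ ≤ 49 * (1 / 90000) :=
    hsq _ (by rw [scale_two, im_affine]; linarith)
  have h4 : ‖E2 (scale 4 τ) - 1‖ ≤ 49 * (1 / 90000) :=
    hsq _ (by rw [scale_four, im_affine, im_affine]; linarith)
  have hF : ‖F2 τ - 1‖ ≤ 6 / 100 := by
    have e : F2 τ - 1 = (4 * (E2 (scale 4 τ) - 1) - (E2 τ - 1)) / 3 := by rw [F2]; ring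
    rw [e, norm_div]
    have := norm_sub_le (4 * (E2 (scale 4 τ) - 1)) (E2 τ - 1)
    rw [norm_mul] at this
    norm_num at this ⊢
    linarith
  have hG : ‖G2 τ - 1‖ ≤ 17 / 100 := by
    have e : G2 τ - 1 = 4 * (E2 (scale 4 τ) - 1) - 4 * (E2 (scale 2 τ) - 1) + (E2 τ - 1) := by
      rw [G2]; ring
    rw [e]
    have t1 := norm_add_le (4 * (E2 (scale 4 τ) - 1) - 4 * (E2 (scale 2 τ) - 1)) (E2 τ - 1)
    have t2 := norm_sub_le (4 * (E2 (scale 4 τ) - 1)) (4 * (E2 (scale 2 τ) - 1))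
    rw [norm_mul, norm_mul] at t2
    norm_num at t1 t2 h1 h2 h4 ⊢
    linarith
  have hsub : ‖F2 τ - G2 τ‖ ≤ 23 / 100 := by
    have := norm_sub_le (F2 τ - 1) (G2 τ - 1)
    rw [sub_sub_sub_cancel_right] at this
    linarith
  have hadd : ‖F2 τ + G2 τ‖ ≤ 223 / 100 := by
    have t1 := norm_add_le ((F2 τ - 1) + (G2 τ - 1)) 2
    have t2 := norm_add_le (F2 τ - 1) (G2 τ - 1)
    rw [show (F2 τ - 1) + (G2 τ - 1) + 2 = F2 τ + G2 τ by ring] at t1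
    norm_num at t1
    linarith
  have hlow : 94 / 100 ≤ ‖F2 τ‖ := by
    have := norm_sub_norm_le (1 : ℂ) (1 - F2 τ)
    rw [sub_sub_cancel, norm_one, norm_sub_rev] at this
    linarith
  rw [invJ, norm_div, norm_pow, div_lt_one (by positivity), sq_sub_sq, norm_mul]
  calc ‖F2 τ + G2 τ‖ * ‖F2 τ - G2 τ‖ ≤ 223 / 100 * (23 / 100) := by gcongr
    _ < (94 / 100) ^ 2 := by norm_num
    _ ≤ ‖F2 τ‖ ^ 2 := by gcongr

/-! ### The hypergeometric coefficients -/

/-- `(1/2)_n / n!`, as a real number. -/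
def halfCoeff (n : ℕ) : ℝ := n.centralBinom / 4 ^ n

@[simp] theorem halfCoeff_zero : halfCoeff 0 = 1 := by simp [halfCoeff]

theorem halfCoeff_pos (n : ℕ) : 0 < halfCoeff n :=
  div_pos (by exact_mod_cast Nat.centralBinom_pos n) (by positivity)

theorem halfCoeff_succ (n : ℕ) :
    halfCoeff (n + 1) * (2 * (n + 1)) = halfCoeff n * (2 * n + 1) := by
  have h : ((n : ℝ) + 1) * (n + 1).centralBinom = 2 * (2 * n + 1) * n.centralBinom := by
    exact_mod_cast Nat.succ_mul_centralBinom_succ n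
  rw [halfCoeff, halfCoeff, pow_succ]
  field_simp
  linear_combination 2 * h

theorem poch_succ (x : ℂ) (n : ℕ) : poch x (n + 1) = poch x n * (x + n) :=
  ascPochhammer_succ_eval n x

theorem poch_one (n : ℕ) : poch 1 n = n.factorial := ascPochhammer_eval_one ℂ n

theorem poch_half (n : ℕ) : poch (1 / 2) n = halfCoeff n * n.factorial := by
  induction n with
  | zero => simp [poch]
  | succ n ih =>
    have h : (halfCoeff (n + 1) : ℂ) * (2 * (n + 1)) = halfCoeff n * (2 * n + 1) := by
      exact_mod_cast halfCoeff_succ n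
    rw [poch_succ, ih, Nat.factorial_succ]
    push_cast
    linear_combination -(n.factorial : ℂ) / 2 * h

theorem R_two (n : ℕ) : R n 2 = halfCoeff n := by
  have h : (Finset.Icc 1 2).filter (fun i => Nat.gcd i 2 = 1) = {1} := by decide
  have h0 : (n.factorial : ℂ) ≠ 0 := by exact_mod_cast n.factorial_ne_zero
  rw [R, h, Finset.prod_singleton]
  push_cast
  rw [poch_half, mul_div_cancel_right₀ _ h0]

theorem hyp32Term_half (x : ℂ) (n : ℕ) :
    hyp32Term (1 / 2) (1 / 2) (1 / 2) 1 1 x n = (halfCoeff n : ℂ) ^ 3 * x ^ n := by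
  have h0 : (n.factorial : ℂ) ≠ 0 := by exact_mod_cast n.factorial_ne_zero
  rw [hyp32Term, poch_half, poch_one]
  field_simp

/-- The left side decreases in n, because (2n+1)(2n+3) ≤ (2n+2)². -/
theorem halfCoeff_sq_le (n : ℕ) : halfCoeff n ^ 2 * (2 * n + 1) ≤ 1 := by
  induction n with
  | zero => simp
  | succ n ih =>
    have h := halfCoeff_succ n
    have hn : (0 : ℝ) ≤ n := n.cast_nonneg
    have h1 : halfCoeff (n + 1) = halfCoeff n * (2 * n + 1) / (2 * (n + 1)) := by
      rw [← h]
      field_simp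
    refine le_trans ?_ ih
    rw [h1, div_pow, div_mul_eq_mul_div, div_le_iff₀ (by positivity)]
    push_cast
    have h2 := mul_nonneg (sq_nonneg (halfCoeff n)) (by positivity : (0 : ℝ) ≤ 2 * n + 1)
    nlinarith

theorem halfCoeff_le_one (n : ℕ) : halfCoeff n ≤ 1 := by
  have h := halfCoeff_sq_le n
  have h0 := halfCoeff_pos n
  have hn : (0 : ℝ) ≤ n := n.cast_nonneg
  nlinarith [mul_nonneg (sq_nonneg (halfCoeff n)) hn]

theorem antitone_halfCoeff : Antitone halfCoeff := by
  refine antitone_nat_of_succ_le fun n => ?_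
  have h := halfCoeff_succ n
  have h0 := halfCoeff_pos n
  have hn : (0 : ℝ) ≤ n := n.cast_nonneg
  nlinarith

theorem summable_sub_of_antitone {f : ℕ → ℝ} (hf : Antitone f) (h0 : ∀ n, 0 ≤ f n) :
    Summable fun n => f n - f (n + 1) := by
  refine summable_of_sum_range_le (c := f 0) (fun n => sub_nonneg.mpr (hf n.le_succ)) fun n => ?_
  rw [Finset.sum_range_sub']
  linarith [h0 n]

/-- With cₙ = `halfCoeff n`, comparison with a telescoping series: cₙ³ ≤ cₙ/(2n+1) ≤ cₙ/(n+1) = 2(cₙ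
- cₙ₊₁). -/
theorem summable_halfCoeff_pow_three : Summable fun n => halfCoeff n ^ 3 := by
  refine Summable.of_nonneg_of_le (fun n => (pow_pos (halfCoeff_pos n) 3).le) (fun n => ?_)
    ((summable_sub_of_antitone antitone_halfCoeff fun n => (halfCoeff_pos n).le).mul_left 2)
  have h := halfCoeff_succ n
  have h0 := halfCoeff_pos n
  have h1 := halfCoeff_sq_le n
  have hn : (0 : ℝ) ≤ n := n.cast_nonneg
  have h2 : halfCoeff n - halfCoeff (n + 1) = halfCoeff n / (2 * (n + 1)) := by
    field_simp
    linarith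
  rw [h2, mul_div_assoc', le_div_iff₀ (by positivity)]
  nlinarith [mul_le_mul_of_nonneg_left h1 h0.le, pow_pos h0 3]

theorem tendsto_halfCoeff : Tendsto halfCoeff atTop (𝓝 0) := by
  have h : Tendsto (fun n : ℕ => Real.sqrt (1 / ((n : ℝ) + 1))) atTop (𝓝 0) := by
    have := (Real.continuous_sqrt.tendsto 0).comp (tendsto_one_div_add_atTop_nhds_zero_nat (𝕜 := ℝ))
    simpa [Function.comp_def] using this
  refine squeeze_zero (fun n => (halfCoeff_pos n).le) (fun n => ?_) h
  refine Real.le_sqrt_of_sq_le ?_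
  have hn : (0 : ℝ) ≤ n := n.cast_nonneg
  rw [le_div_iff₀ (by positivity)]
  nlinarith [halfCoeff_sq_le n, sq_nonneg (halfCoeff n)]

/-- The coefficients `n ((1/2)_n / n!)³`. -/
def derivCoeff (n : ℕ) : ℝ := n * halfCoeff n ^ 3

theorem derivCoeff_nonneg (n : ℕ) : 0 ≤ derivCoeff n :=
  mul_nonneg n.cast_nonneg (pow_pos (halfCoeff_pos n) 3).le

theorem tendsto_derivCoeff : Tendsto derivCoeff atTop (𝓝 0) := by
  refine squeeze_zero derivCoeff_nonneg (fun n => ?_) tendsto_halfCoeff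
  have h1 := halfCoeff_sq_le n
  have h0 := halfCoeff_pos n
  have hn : (0 : ℝ) ≤ n := n.cast_nonneg
  rw [derivCoeff]
  nlinarith [mul_le_mul_of_nonneg_left h1 h0.le, pow_pos h0 3, mul_nonneg hn (pow_pos h0 3).le]

/-- The shift is needed: `derivCoeff` is 0 at 0 and positive at 1. -/
theorem antitone_derivCoeff_succ : Antitone fun n => derivCoeff (n + 1) := by
  refine antitone_nat_of_succ_le fun m => ?_
  have h := halfCoeff_succ (m + 1)
  have h0 := halfCoeff_pos (m + 1)
  have hm : (0 : ℝ) ≤ m := m.cast_nonneg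
  push_cast at h
  have h1 : halfCoeff (m + 1 + 1) =
      halfCoeff (m + 1) * (2 * (m + 1) + 1) / (2 * (m + 1 + 1)) := by
    rw [← h]
    field_simp
  rw [derivCoeff, derivCoeff, h1, div_pow, mul_div_assoc', div_le_iff₀ (by positivity)]
  push_cast
  have h2 : ((m : ℝ) + 1 + 1) * (2 * (m + 1) + 1) ^ 3 ≤ (m + 1) * (2 * (m + 1 + 1)) ^ 3 := by
    have h3 : (2 * ((m : ℝ) + 1) + 1) ^ 3 ≤ 8 * ((m + 1) * (m + 1 + 1) ^ 2) := by
      nlinarith [mul_nonneg hm hm]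
    nlinarith
  nlinarith [mul_le_mul_of_nonneg_left h2 (pow_pos h0 3).le]

/-- The differences of consecutive terms of `derivCoeff`. -/
def diffCoeff (n : ℕ) : ℝ := derivCoeff n - derivCoeff (n - 1)

theorem summable_abs_diffCoeff : Summable fun n => |diffCoeff n| := by
  -- From index 2 on the differences are nonpositive and telescope; index 0 involves the truncated n
  -- - 1, and index 1 is the initial rise.
  rw [← summable_nat_add_iff 2]
  refine (summable_sub_of_antitone antitone_derivCoeff_succ
    fun n => derivCoeff_nonneg _).congr fun n => ?_
  have h := antitone_derivCoeff_succ n.le_succ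
  simp only [Nat.succ_eq_add_one] at h
  rw [diffCoeff, abs_of_nonpos (by simpa using h)]
  simp

theorem continuousOn_tsum_mul_pow {c : ℕ → ℝ} (hc : Summable fun n => |c n|) :
    ContinuousOn (fun x : ℂ => ∑' n, (c n : ℂ) * x ^ n) (Metric.closedBall 0 1) := by
  refine continuousOn_tsum (fun n => by fun_prop) hc fun n x hx => ?_
  rw [mem_closedBall_zero_iff] at hx
  rw [norm_mul, norm_pow, Complex.norm_real, Real.norm_eq_abs]
  exact mul_le_of_le_one_right (abs_nonneg _) (pow_le_one₀ (norm_nonneg _) hx)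

theorem hasSum_mul_pow {c : ℕ → ℝ} (hc : Summable fun n => |c n|) {x : ℂ} (hx : ‖x‖ ≤ 1) :
    HasSum (fun n => (c n : ℂ) * x ^ n) (∑' n, (c n : ℂ) * x ^ n) := by
  refine Summable.hasSum (Summable.of_norm_bounded hc fun n => ?_)
  rw [norm_mul, norm_pow, Complex.norm_real, Real.norm_eq_abs]
  exact mul_le_of_le_one_right (abs_nonneg _) (pow_le_one₀ (norm_nonneg _) hx)

theorem one_sub_mul_sum_derivCoeff (x : ℂ) (N : ℕ) :
    (1 - x) * ∑ n ∈ Finset.range (N + 1), (derivCoeff n : ℂ) * x ^ n =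
      ∑ n ∈ Finset.range (N + 1), (diffCoeff n : ℂ) * x ^ n - derivCoeff N * x ^ (N + 1) := by
  induction N with
  | zero => simp [derivCoeff, diffCoeff]
  | succ N ih =>
    rw [Finset.sum_range_succ, mul_add, ih, Finset.sum_range_succ _ (N + 1), diffCoeff]
    push_cast [Nat.add_sub_cancel]
    ring

/-- `∑ dₙ xⁿ`, where `dₙ` are the differences of the coefficients of `∑ n aₙ xⁿ`. -/
def diffSeries (x : ℂ) : ℂ := ∑' n, (diffCoeff n : ℂ) * x ^ n

/-- Dirichlet's test with an explicit limit: summation by parts leaves the boundary term `derivCoeff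
N * x ^ (N + 1)`, which tends to 0 on the closed disc. -/
theorem tendsto_sum_derivCoeff {x : ℂ} (hx : ‖x‖ ≤ 1) (hx1 : x ≠ 1) :
    Tendsto (fun N => ∑ n ∈ Finset.range N, (derivCoeff n : ℂ) * x ^ n) atTop
      (𝓝 (diffSeries x / (1 - x))) := by
  have h1 : 1 - x ≠ 0 := sub_ne_zero.mpr hx1.symm
  rw [← tendsto_add_atTop_iff_nat 1]
  have h2 := ((tendsto_add_atTop_iff_nat 1).mpr
    (hasSum_mul_pow summable_abs_diffCoeff hx).tendsto_sum_nat)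
  have h3 : Tendsto (fun N => (derivCoeff N : ℂ) * x ^ (N + 1)) atTop (𝓝 0) := by
    refine squeeze_zero_norm (fun N => ?_) tendsto_derivCoeff
    rw [norm_mul, norm_pow, Complex.norm_real, Real.norm_of_nonneg (derivCoeff_nonneg N)]
    exact mul_le_of_le_one_right (derivCoeff_nonneg N) (pow_le_one₀ (norm_nonneg _) hx)
  have h4 := (h2.sub h3).div_const (1 - x)
  rw [sub_zero] at h4
  refine h4.congr fun N => ?_
  rw [← one_sub_mul_sum_derivCoeff, mul_div_cancel_left₀ _ h1]

/-! ### The hypergeometric series and its derivatives -/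

/-- `∑ nᵏ aₙ xⁿ`, where `aₙ = ((1/2)_n / n!)³`. -/
def hyp (k : ℕ) (x : ℂ) : ℂ := ∑' n : ℕ, (n : ℂ) ^ k * (halfCoeff n : ℂ) ^ 3 * x ^ n

theorem norm_coeff_le (k n : ℕ) : ‖(n : ℂ) ^ k * (halfCoeff n : ℂ) ^ 3‖ ≤ (n : ℝ) ^ k := by
  rw [norm_mul, norm_pow, norm_pow, Complex.norm_natCast, Complex.norm_real,
    Real.norm_of_nonneg (halfCoeff_pos n).le]
  exact mul_le_of_le_one_right (by positivity)
    (pow_le_one₀ (halfCoeff_pos n).le (halfCoeff_le_one n))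

theorem hasSum_hyp (k : ℕ) {x : ℂ} (hx : ‖x‖ < 1) :
    HasSum (fun n : ℕ => (n : ℂ) ^ k * (halfCoeff n : ℂ) ^ 3 * x ^ n) (hyp k x) := by
  refine Summable.hasSum (Summable.of_norm_bounded
    (summable_pow_mul_geometric_of_norm_lt_one k (r := ‖x‖) (by simpa using hx)) fun n => ?_)
  rw [norm_mul, norm_pow]
  gcongr
  exact norm_coeff_le k n

/-- Termwise differentiation on a ball of radius r < 1. Only the product x d is identified: this
avoids dividing at x = 0, and `D_invJ` supplies the factor x. -/
theorem exists_hasDerivAt_hyp (k : ℕ) {x : ℂ} (hx : ‖x‖ < 1) :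
    ∃ d, HasDerivAt (hyp k) d x ∧ x * d = hyp (k + 1) x := by
  obtain ⟨r, hxr, hr1⟩ := exists_between hx
  have hr0 : 0 < r := (norm_nonneg x).trans_lt hxr
  have hu : Summable fun n : ℕ => r⁻¹ * ((n : ℝ) ^ (k + 1) * r ^ n) :=
    (summable_pow_mul_geometric_of_norm_lt_one (k + 1) (r := r)
      (by rwa [Real.norm_of_nonneg hr0.le])).mul_left _
  have hd := hasDerivAt_tsum_of_isPreconnected (𝕜 := ℂ) (t := Metric.ball 0 r)
    (g := fun (n : ℕ) (y : ℂ) => (n : ℂ) ^ k * (halfCoeff n : ℂ) ^ 3 * y ^ n)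
    (g' := fun (n : ℕ) (y : ℂ) => (n : ℂ) ^ k * (halfCoeff n : ℂ) ^ 3 * (n * y ^ (n - 1)))
    (y₀ := 0) (y := x) hu Metric.isOpen_ball (convex_ball 0 r).isPreconnected
    (fun n y _ => (hasDerivAt_pow n y).const_mul _) (fun n y hy => ?_)
    (Metric.mem_ball_self hr0) (hasSum_hyp k (by simp)).summable (by simpa using hxr)
  · refine ⟨_, hd, ?_⟩
    rw [← tsum_mul_left, hyp]
    refine tsum_congr fun n => ?_
    cases n with
    | zero => simp
    | succ n =>
      simp only [Nat.add_sub_cancel]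
      ring
  · rw [mem_ball_zero_iff] at hy
    cases n with
    | zero => simp
    | succ n =>
      rw [norm_mul, norm_mul (((n + 1 : ℕ) : ℂ)), Complex.norm_natCast, norm_pow]
      simp only [Nat.add_sub_cancel]
      calc _ ≤ ((n + 1 : ℕ) : ℝ) ^ k * (((n + 1 : ℕ) : ℝ) * r ^ n) := by
            gcongr
            exact norm_coeff_le k _
        _ = _ := by
            rw [pow_succ r]
            field_simp
            ring

/-- With ϑ = x d/dx this is ϑ³ = x(ϑ + 1/2)³, the cube of the recurrence `halfCoeff_succ`. -/
theorem hyp_ode {x : ℂ} (hx : ‖x‖ < 1) :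
    (1 - x) * hyp 3 x = x * (3 / 2 * hyp 2 x + 3 / 4 * hyp 1 x + 1 / 8 * hyp 0 x) := by
  have h3 := (hasSum_nat_add_iff' 1).mpr (hasSum_hyp 3 hx)
  simp only [Finset.range_one, Finset.sum_singleton, Nat.cast_zero, ne_eq, OfNat.ofNat_ne_zero,
    not_false_eq_true, zero_pow, zero_mul, sub_zero] at h3
  have h := ((((hasSum_hyp 3 hx).add ((hasSum_hyp 2 hx).mul_left (3 / 2))).add
    ((hasSum_hyp 1 hx).mul_left (3 / 4))).add ((hasSum_hyp 0 hx).mul_left (1 / 8))).mul_left x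
  have heq := h3.unique (h.congr_fun ?_)
  · linear_combination heq
  · intro n
    have hr : (halfCoeff (n + 1) : ℂ) * (2 * (n + 1)) = halfCoeff n * (2 * n + 1) := by
      exact_mod_cast halfCoeff_succ n
    have hr3 := congrArg (fun z : ℂ => z ^ 3) hr
    push_cast
    simp only [mul_pow] at hr3
    rw [pow_succ x]
    linear_combination (x ^ n * x / 8) * hr3

theorem hyp_zero_zero : hyp 0 0 = 1 := by
  rw [hyp, tsum_eq_single 0]
  · simp
  · intro n hn
    simp [hn]

theorem hasSum_hyp_zero {x : ℂ} (hx : ‖x‖ ≤ 1) :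
    HasSum (fun n : ℕ => (halfCoeff n : ℂ) ^ 3 * x ^ n) (hyp 0 x) := by
  have hs : Summable fun n => |halfCoeff n ^ 3| := by
    simpa [abs_of_pos, halfCoeff_pos] using summable_halfCoeff_pow_three
  have := hasSum_mul_pow hs hx
  simpa [hyp] using this

theorem continuousOn_hyp_zero : ContinuousOn (hyp 0) (Metric.closedBall 0 1) := by
  have hs : Summable fun n => |halfCoeff n ^ 3| := by
    simpa [abs_of_pos, halfCoeff_pos] using summable_halfCoeff_pow_three
  have := continuousOn_tsum_mul_pow hs
  unfold hyp
  simpa using this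

theorem continuousOn_diffSeries : ContinuousOn diffSeries (Metric.closedBall 0 1) :=
  continuousOn_tsum_mul_pow summable_abs_diffCoeff

theorem diffSeries_eq {x : ℂ} (hx : ‖x‖ < 1) : diffSeries x = (1 - x) * hyp 1 x := by
  have hx1 : x ≠ 1 := by
    rintro rfl
    simp at hx
  have h1 : 1 - x ≠ 0 := sub_ne_zero.mpr hx1.symm
  have h := (hasSum_hyp 1 hx).tendsto_sum_nat
  have h2 := tendsto_sum_derivCoeff hx.le hx1
  have h3 := tendsto_nhds_unique h (h2.congr fun N => Finset.sum_congr rfl fun n _ => by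
    simp [derivCoeff])
  rw [h3, mul_div_cancel₀ _ h1]

/-! ### The hypergeometric series along `1 / J₄` -/

theorem hasDerivAt_hyp_invJ (k : ℕ) {τ : ℍ} (hτ : ‖invJ τ‖ < 1) :
    HasDerivAt (fun z => hyp k (invJ (ofComplex z)))
      (2 * Real.pi * Complex.I * (G2 τ * hyp (k + 1) (invJ τ))) τ := by
  obtain ⟨d, hd, hxd⟩ := exists_hasDerivAt_hyp k hτ
  have h := hasDerivAt_comp_ofComplex mdiff_invJ τ
  have hd' : HasDerivAt (hyp k) d ((invJ ∘ ofComplex) (τ : ℂ)) := by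
    rwa [Function.comp_apply, ofComplex_apply]
  convert! hd'.comp (τ : ℂ) h using 1
  rw [D_invJ, ← hxd]
  ring

/-- A quotient rule that keeps the denominator F, so that it can be iterated. -/
theorem hasDerivAt_div_of_logDeriv {F N : ℂ → ℂ} {c f n q z : ℂ} (hF : HasDerivAt F (c * (f * q)) z)
    (hN : HasDerivAt N (c * n) z) (hFz : F z = f) (hf : f ≠ 0) :
    HasDerivAt (fun w => N w / F w) (c * ((n - N z * q) / f)) z := by
  have h := hN.div hF (hFz ▸ hf)
  rw [hFz] at h
  convert! h using 1
  field_simp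

/-- The numerator of the derivative of `₃F₂(1/J₄) / F₂`. -/
def numer₁ (τ : ℍ) : ℂ := G2 τ * hyp 1 (invJ τ) - (P2 τ - G2 τ) * hyp 0 (invJ τ) / 3

/-- The numerator of the second derivative of `₃F₂(1/J₄) / F₂`. -/
def numer₂ (τ : ℍ) : ℂ :=
  G2 τ ^ 2 * hyp 2 (invJ τ)
    + (-2 * P2 τ * G2 τ - 3 * F2 τ ^ 2 + 5 * G2 τ ^ 2) / 6 * hyp 1 (invJ τ)
    + (P2 τ ^ 2 - 2 * P2 τ * G2 τ + 13 / 4 * G2 τ ^ 2 - 9 / 4 * F2 τ ^ 2) / 18 * hyp 0 (invJ τ)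

theorem hasDerivAt_F2 (τ : ℍ) : HasDerivAt (fun z => F2 (ofComplex z))
    (2 * Real.pi * Complex.I * (F2 τ * ((P2 τ - G2 τ) / 3))) τ := by
  have h := hasDerivAt_comp_ofComplex mdiff_F2 τ
  rwa [D_F2, mul_div_assoc] at h

theorem hasDerivAt_G2 (τ : ℍ) : HasDerivAt (fun z => G2 (ofComplex z))
    (2 * Real.pi * Complex.I * ((2 * P2 τ * G2 τ - 3 * F2 τ ^ 2 + G2 τ ^ 2) / 6)) τ := by
  have h := hasDerivAt_comp_ofComplex mdiff_G2 τ
  rwa [D_G2] at h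

theorem hasDerivAt_P2 (τ : ℍ) : HasDerivAt (fun z => P2 (ofComplex z))
    (2 * Real.pi * Complex.I * ((P2 τ ^ 2 - (3 * F2 τ ^ 2 + G2 τ ^ 2) / 4) / 6)) τ := by
  have h := hasDerivAt_comp_ofComplex mdiff_P2 τ
  rwa [D_P2] at h

theorem hasDerivAt_ratio {τ : ℍ} (hτ : ‖invJ τ‖ < 1) :
    HasDerivAt (fun z => hyp 0 (invJ (ofComplex z)) / F2 (ofComplex z))
      (2 * Real.pi * Complex.I * (numer₁ τ / F2 τ)) τ := by
  have h := hasDerivAt_div_of_logDeriv (hasDerivAt_F2 τ) (hasDerivAt_hyp_invJ 0 hτ)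
    (by rw [ofComplex_apply]) (F2_ne_zero τ)
  convert! h using 3
  rw [numer₁, ofComplex_apply]
  ring

theorem hasDerivAt_numer₁ {τ : ℍ} (hτ : ‖invJ τ‖ < 1) :
    HasDerivAt (fun z => numer₁ (ofComplex z) / F2 (ofComplex z))
      (2 * Real.pi * Complex.I * (numer₂ τ / F2 τ)) τ := by
  have hN := ((hasDerivAt_G2 τ).mul (hasDerivAt_hyp_invJ 1 hτ)).sub
    ((((hasDerivAt_P2 τ).sub (hasDerivAt_G2 τ)).mul (hasDerivAt_hyp_invJ 0 hτ)).div_const 3)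
  simp only [Pi.sub_apply, ofComplex_apply] at hN
  have h := hasDerivAt_div_of_logDeriv (c := 2 * Real.pi * Complex.I)
    (N := fun z => numer₁ (ofComplex z)) (n := numer₂ τ + numer₁ τ * ((P2 τ - G2 τ) / 3))
    (hasDerivAt_F2 τ) ?_ (by rw [ofComplex_apply]) (F2_ne_zero τ)
  · convert! h using 3
    rw [ofComplex_apply]
    ring
  · convert! hN using 1
    rw [numer₁, numer₂]
    ring

/-- The third derivative of ₃F₂(1/J₄)/F₂ vanishes: `hyp_ode` eliminates `hyp 3`, and the system for
F₂, G₂, P₂ cancels the rest. -/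
theorem hasDerivAt_numer₂ {τ : ℍ} (hτ : ‖invJ τ‖ < 1) :
    HasDerivAt (fun z => numer₂ (ofComplex z) / F2 (ofComplex z)) 0 τ := by
  have hF := hasDerivAt_F2 τ
  have hG := hasDerivAt_G2 τ
  have hP := hasDerivAt_P2 τ
  have hN := (((hG.fun_pow 2).mul (hasDerivAt_hyp_invJ 2 hτ)).add
    (((((hP.const_mul (-2)).mul hG).sub ((hF.fun_pow 2).const_mul 3)).add
      ((hG.fun_pow 2).const_mul 5)).div_const 6 |>.mul (hasDerivAt_hyp_invJ 1 hτ))).add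
    ((((((hP.fun_pow 2).sub ((hP.const_mul 2).mul hG)).add ((hG.fun_pow 2).const_mul (13 / 4))).sub
      ((hF.fun_pow 2).const_mul (9 / 4))).div_const 18).mul (hasDerivAt_hyp_invJ 0 hτ))
  simp only [Pi.sub_apply, Pi.add_apply, Pi.mul_apply, ofComplex_apply] at hN
  have hode := hyp_ode hτ
  have hF0 := F2_ne_zero τ
  rw [one_sub_invJ, show invJ τ = (F2 τ ^ 2 - G2 τ ^ 2) / F2 τ ^ 2 from rfl] at hode
  field_simp at hode
  rw [show (F2 τ ^ 2 - G2 τ ^ 2) / F2 τ ^ 2 = invJ τ from rfl] at hode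
  have h := hasDerivAt_div_of_logDeriv (c := 2 * Real.pi * Complex.I)
    (N := fun z => numer₂ (ofComplex z)) (n := numer₂ τ * ((P2 τ - G2 τ) / 3))
    hF ?_ (by rw [ofComplex_apply]) hF0
  · convert! h using 1
    rw [ofComplex_apply]
    ring
  · convert! hN using 1
    rw [numer₂]
    push_cast
    linear_combination (-(Real.pi * Complex.I * G2 τ) / 32) * hode

theorem ofComplex_add_one {z : ℂ} (hz : 0 < z.im) :
    ofComplex (z + 1) = affine 1 one_pos 1 (ofComplex z) := by
  have hz' : 0 < (z + 1).im := by simpa using hz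
  rw [ofComplex_apply_of_im_pos hz, ofComplex_apply_of_im_pos hz']
  apply UpperHalfPlane.ext
  simp

/-- A periodic function with constant derivative near the cusp is constant there. -/
theorem const_of_deriv_const {f : ℍ → ℂ} {k : ℂ}
    (hf : ∀ τ : ℍ, 1 < τ.im → HasDerivAt (fun z => f (ofComplex z)) k τ)
    (hper : ∀ τ : ℍ, f (affine 1 one_pos 1 τ) = f τ) :
    k = 0 ∧ ∀ σ τ : ℍ, 1 < σ.im → 1 < τ.im → f σ = f τ := by
  have hd : ∀ z : ℂ, 1 < z.im → HasDerivAt (fun z => f (ofComplex z) - k * z) 0 z := fun z hz => by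
    have h := (hf ⟨z, one_pos.trans hz⟩ hz).fun_sub ((hasDerivAt_id z).const_mul k)
    rwa [mul_one, sub_self] at h
  have hopen : IsOpen {z : ℂ | 1 < z.im} := isOpen_lt continuous_const Complex.continuous_im
  have hconst : ∀ z w : ℂ, 1 < z.im → 1 < w.im →
      f (ofComplex z) - k * z = f (ofComplex w) - k * w := fun z w hz hw =>
    hopen.is_const_of_deriv_eq_zero (convex_halfSpace_im_gt 1).isPreconnected
      (fun z hz => (hd z hz).differentiableAt.differentiableWithinAt)
      (fun z hz => (hd z hz).deriv) hz hw
  -- f - kz is constant; comparing 2i + 1 with 2i, periodicity of f leaves k = 0.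
  have hk : k = 0 := by
    have h := hconst (2 * Complex.I + 1) (2 * Complex.I) (by simp) (by simp)
    rw [ofComplex_add_one (by simp), hper] at h
    linear_combination -h
  refine ⟨hk, fun σ τ hσ hτ => ?_⟩
  simpa [hk, ofComplex_apply] using hconst σ τ hσ hτ

/-- Descent through the derivatives of the ratio: the second is constant, so the first is constant
by periodicity, and then so is the ratio itself, whose limit at the cusp is 1. -/
theorem hyp_invJ_of_one_lt_im {τ : ℍ} (hτ : 1 < τ.im) : hyp 0 (invJ τ) = F2 τ := by
  obtain ⟨-, h2⟩ := const_of_deriv_const (f := fun τ => numer₂ τ / F2 τ)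
    (fun σ hσ => hasDerivAt_numer₂ (norm_invJ_lt_one hσ.le)) fun σ => by
      simp only [numer₂, F2_add_one, G2_add_one, P2_add_one, invJ_add_one]
  obtain ⟨-, h1⟩ := const_of_deriv_const (f := fun τ => numer₁ τ / F2 τ)
    (k := 2 * Real.pi * Complex.I * (numer₂ τ / F2 τ))
    (fun σ hσ => h2 σ τ hσ hτ ▸ hasDerivAt_numer₁ (norm_invJ_lt_one hσ.le)) fun σ => by
      simp only [numer₁, F2_add_one, G2_add_one, P2_add_one, invJ_add_one]
  obtain ⟨-, h0⟩ := const_of_deriv_const (f := fun τ => hyp 0 (invJ τ) / F2 τ)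
    (k := 2 * Real.pi * Complex.I * (numer₁ τ / F2 τ))
    (fun σ hσ => h1 σ τ hσ hτ ▸ hasDerivAt_ratio (norm_invJ_lt_one hσ.le)) fun σ => by
      simp only [F2_add_one, invJ_add_one]
  have hlim : Tendsto (fun σ : ℍ => hyp 0 (invJ σ) / F2 σ) atImInfty (𝓝 1) := by
    have hc : ContinuousAt (hyp 0) 0 :=
      continuousOn_hyp_zero.continuousAt (Metric.closedBall_mem_nhds 0 one_pos)
    have h := (hc.tendsto.comp tendsto_invJ).div tendsto_F2 one_ne_zero
    rwa [hyp_zero_zero, div_one] at h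
  have hev : (fun σ : ℍ => hyp 0 (invJ σ) / F2 σ) =ᶠ[atImInfty]
      fun _ => hyp 0 (invJ τ) / F2 τ := by
    rw [Filter.EventuallyEq, Filter.Eventually, atImInfty_mem]
    refine ⟨2, fun σ hσ => ?_⟩
    exact h0 σ τ (by linarith) hτ
  have h := tendsto_nhds_unique (hlim.congr' hev) tendsto_const_nhds
  rw [eq_comm, div_eq_one_iff_eq (F2_ne_zero τ)] at h
  exact h

/-! ### The domain -/

theorem setOf_one_lt_norm_J4 : {τ : ℍ | 1 < ‖J4 τ‖} = {τ | ‖invJ τ‖ < 1} :=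
  Set.ext one_lt_norm_J4_iff

theorem mem_cuspDomain_of_one_le_im {τ : ℍ} (hτ : 1 ≤ τ.im) : τ ∈ cuspDomain := by
  have hpre : IsPreconnected {τ : ℍ | 1 ≤ τ.im} := by
    rw [← isEmbedding_coe.isInducing.isPreconnected_image]
    have : ((↑) : ℍ → ℂ) '' {τ : ℍ | 1 ≤ τ.im} = {z : ℂ | 1 ≤ z.im} := by
      ext z
      constructor
      · rintro ⟨τ, hτ, rfl⟩
        exact hτ
      · intro hz
        exact ⟨⟨z, one_pos.trans_le hz⟩, hz, rfl⟩
    rw [this]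
    exact (convex_halfSpace_im_ge 1).isPreconnected
  refine hpre.subset_connectedComponentIn (x := UpperHalfPlane.I) (by simp) (fun σ hσ => ?_) hτ
  exact (one_lt_norm_J4_iff σ).mpr (norm_invJ_lt_one hσ)

theorem norm_invJ_lt_of_mem_cuspDomain {τ : ℍ} (hτ : τ ∈ cuspDomain) : ‖invJ τ‖ < 1 :=
  (one_lt_norm_J4_iff τ).mp (connectedComponentIn_subset {τ | 1 < ‖J4 τ‖} _ hτ)

theorem isOpen_cuspDomain : IsOpen cuspDomain := by
  have : LocallyConnectedSpace ℍ := isOpenEmbedding_coe.locallyConnectedSpace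
  refine IsOpen.connectedComponentIn ?_
  rw [setOf_one_lt_norm_J4]
  exact isOpen_lt continuous_invJ.norm continuous_const

theorem hyp_invJ_of_mem_cuspDomain {τ : ℍ} (hτ : τ ∈ cuspDomain) : hyp 0 (invJ τ) = F2 τ := by
  let V : Set ℂ := ((↑) : ℍ → ℂ) '' cuspDomain
  have hV : IsOpen V := isOpenEmbedding_coe.isOpenMap _ isOpen_cuspDomain
  have hVc : IsPreconnected V :=
    isPreconnected_connectedComponentIn.image _ continuous_coe.continuousOn
  have h1 : DifferentiableOn ℂ (fun z => hyp 0 (invJ (ofComplex z))) V := by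
    rintro _ ⟨σ, hσ, rfl⟩
    exact (hasDerivAt_hyp_invJ 0
      (norm_invJ_lt_of_mem_cuspDomain hσ)).differentiableAt.differentiableWithinAt
  have h2 : DifferentiableOn ℂ (fun z => F2 (ofComplex z)) V := by
    rintro _ ⟨σ, hσ, rfl⟩
    exact (hasDerivAt_F2 σ).differentiableAt.differentiableWithinAt
  have h2I : 1 < (2 * Complex.I).im := by simp
  have hmem : (2 * Complex.I : ℂ) ∈ V :=
    ⟨⟨2 * Complex.I, one_pos.trans h2I⟩, mem_cuspDomain_of_one_le_im h2I.le, rfl⟩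
  have h := (h1.analyticOnNhd hV).eqOn_of_preconnected_of_eventuallyEq (h2.analyticOnNhd hV) hVc
    hmem (by
      filter_upwards [(isOpen_lt continuous_const Complex.continuous_im).mem_nhds h2I] with z hz
      have h0 : 0 < z.im := one_pos.trans hz
      rw [ofComplex_apply_of_im_pos h0]
      exact hyp_invJ_of_one_lt_im hz)
  have := h ⟨τ, hτ, rfl⟩
  simpa only [ofComplex_apply] using this

/-- Both sides are the derivative of the same function, up to the factor 2πi, since the
hypergeometric identity holds on an open set. -/
theorem G2_mul_hyp_one {τ : ℍ} (hτ : τ ∈ cuspDomain) :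
    G2 τ * hyp 1 (invJ τ) = F2 τ * ((P2 τ - G2 τ) / 3) := by
  have h1 := hasDerivAt_hyp_invJ 0 (norm_invJ_lt_of_mem_cuspDomain hτ)
  have hV : IsOpen (((↑) : ℍ → ℂ) '' cuspDomain) :=
    isOpenEmbedding_coe.isOpenMap _ isOpen_cuspDomain
  have h2 : (fun z => F2 (ofComplex z)) =ᶠ[𝓝 (τ : ℂ)]
      fun z => hyp 0 (invJ (ofComplex z)) := by
    filter_upwards [hV.mem_nhds ⟨τ, hτ, rfl⟩] with z hz
    obtain ⟨σ, hσ, rfl⟩ := hz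
    rw [ofComplex_apply, hyp_invJ_of_mem_cuspDomain hσ]
  have h3 := (h1.congr_of_eventuallyEq h2).unique (hasDerivAt_F2 τ)
  exact mul_left_cancel₀ Complex.two_pi_I_ne_zero h3

/-! ### The boundary of the domain -/

theorem norm_invJ_le_of_mem_closure {τ : ℍ} (hτ : τ ∈ closure cuspDomain) : ‖invJ τ‖ ≤ 1 :=
  closure_minimal (s := cuspDomain) (t := {τ | ‖invJ τ‖ ≤ 1})
    (fun _ hσ => (norm_invJ_lt_of_mem_cuspDomain hσ).le)
    (isClosed_le continuous_invJ.norm continuous_const) hτ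

theorem continuousOn_comp_invJ {f : ℂ → ℂ} (hf : ContinuousOn f (Metric.closedBall 0 1)) :
    ContinuousOn (fun τ => f (invJ τ)) (closure cuspDomain) :=
  hf.comp continuous_invJ.continuousOn fun _ hτ => by
    simpa using norm_invJ_le_of_mem_closure hτ

theorem hyp_invJ_of_mem_closure {τ : ℍ} (hτ : τ ∈ closure cuspDomain) :
    hyp 0 (invJ τ) = F2 τ :=
  Set.EqOn.of_subset_closure (s := cuspDomain) (fun _ hσ => hyp_invJ_of_mem_cuspDomain hσ)
    (continuousOn_comp_invJ continuousOn_hyp_zero) continuous_F2.continuousOn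
    subset_closure subset_rfl hτ

/-- The preceding derivative identity times 1 - 1/J₄: in this form both sides are continuous up to
the boundary. -/
theorem G2_mul_diffSeries {τ : ℍ} (hτ : τ ∈ closure cuspDomain) :
    G2 τ * diffSeries (invJ τ) = (1 - invJ τ) * (F2 τ * ((P2 τ - G2 τ) / 3)) := by
  refine Set.EqOn.of_subset_closure (s := cuspDomain)
    (f := fun τ => G2 τ * diffSeries (invJ τ))
    (g := fun τ => (1 - invJ τ) * (F2 τ * ((P2 τ - G2 τ) / 3))) (fun σ hσ => ?_)
    (continuous_G2.continuousOn.mul (continuousOn_comp_invJ continuousOn_diffSeries))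
    (Continuous.continuousOn ?_) subset_closure subset_rfl hτ
  · simp only
    rw [diffSeries_eq (norm_invJ_lt_of_mem_cuspDomain hσ), ← G2_mul_hyp_one hσ]
    ring
  · exact (continuous_const.sub continuous_invJ).mul
      (continuous_F2.mul ((continuous_P2.sub continuous_G2).div_const 3))

theorem G2_ne_zero_of_J4_ne_one {τ : ℍ} (h : J4 τ ≠ 1) : G2 τ ≠ 0 := by
  intro hG
  apply h
  rw [J4, hG]
  have := F2_ne_zero τ
  field_simp
  simp

theorem invJ_ne_one_of_J4_ne_one {τ : ℍ} (h : J4 τ ≠ 1) : invJ τ ≠ 1 := by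
  rw [← one_div_J4]
  intro h1
  exact h (by rw [← one_div_one_div (J4 τ), h1, div_one])

theorem J4_ne_one_of_mem_cuspDomain {τ : ℍ} (hτ : τ ∈ cuspDomain) : J4 τ ≠ 1 := by
  intro h
  have h1 := norm_invJ_lt_of_mem_cuspDomain hτ
  rw [← one_div_J4, h] at h1
  simp at h1

theorem piTerm_eq (τ : ℍ) (n : ℕ) :
    piTerm τ n = 3 * ((derivCoeff n : ℂ) * invJ τ ^ n)
      + (1 - P2star τ / G2 τ) * ((halfCoeff n : ℂ) ^ 3 * invJ τ ^ n) := by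
  rw [piTerm, R_two, ← one_div_J4, derivCoeff, one_div, inv_pow]
  push_cast
  ring

/-- P₂ and G₂ cancel, leaving only the non-holomorphic part of P₂*. -/
theorem piTerm_sum_value {τ : ℍ} (hG : G2 τ ≠ 0) :
    3 * (F2 τ * ((P2 τ - G2 τ) / 3) / G2 τ) + (1 - P2star τ / G2 τ) * F2 τ =
      3 / (2 * (Real.pi : ℂ) * (τ.im : ℂ)) * (F2 τ / G2 τ) := by
  have hP : P2star τ = P2 τ - 3 / (2 * (Real.pi : ℂ) * (τ.im : ℂ)) := rfl
  rw [hP]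
  field_simp
  ring

theorem hasSum_piTerm {τ : ℍ} (hτ : τ ∈ cuspDomain) (hG : G2 τ ≠ 0) :
    HasSum (piTerm τ) (3 / (2 * (Real.pi : ℂ) * (τ.im : ℂ)) * (F2 τ / G2 τ)) := by
  have hlt := norm_invJ_lt_of_mem_cuspDomain hτ
  have h1 := (hasSum_hyp 1 hlt).mul_left 3
  have h2 := (hasSum_hyp_zero hlt.le).mul_left (1 - P2star τ / G2 τ)
  rw [hyp_invJ_of_mem_cuspDomain hτ] at h2
  rw [eq_div_of_mul_eq hG ((mul_comm _ _).trans (G2_mul_hyp_one hτ))] at h1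
  rw [← piTerm_sum_value hG]
  refine (h1.add h2).congr_fun fun n => ?_
  rw [piTerm_eq, derivCoeff]
  push_cast
  ring

theorem tendsto_sum_piTerm {τ : ℍ} (hτ : τ ∈ closure cuspDomain) (hJ : J4 τ ≠ 1) :
    Tendsto (fun N : ℕ => ∑ n ∈ Finset.range N, piTerm τ n) atTop
      (𝓝 (3 / (2 * (Real.pi : ℂ) * (τ.im : ℂ)) * (F2 τ / G2 τ))) := by
  have hG := G2_ne_zero_of_J4_ne_one hJ
  have hle := norm_invJ_le_of_mem_closure hτ
  have hne := invJ_ne_one_of_J4_ne_one hJ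
  have h1 := (tendsto_sum_derivCoeff hle hne).const_mul 3
  have h2 := (hasSum_hyp_zero hle).tendsto_sum_nat.const_mul (1 - P2star τ / G2 τ)
  rw [hyp_invJ_of_mem_closure hτ] at h2
  -- Dividing by 1 - 1/J₄ is allowed because J₄ ≠ 1; this is the sum of n aₙ xⁿ as a limit of
  -- partial sums.
  have hval : diffSeries (invJ τ) / (1 - invJ τ) = F2 τ * ((P2 τ - G2 τ) / 3) / G2 τ := by
    rw [div_eq_div_iff (sub_ne_zero.mpr hne.symm) hG, mul_comm, G2_mul_diffSeries hτ, mul_comm]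
  rw [hval] at h1
  rw [← piTerm_sum_value hG]
  refine (h1.add h2).congr fun N => ?_
  simp only [piTerm_eq, Finset.sum_add_distrib, Finset.mul_sum]

end RamanujanLevelFour

end

theorem mainTheorem4 :
    -- the domain contains all points with large imaginary part
    (∀ τ : UpperHalfPlane, 1 ≤ τ.im → τ ∈ RamanujanLevelFour.cuspDomain) ∧
    -- the hypergeometric identity, up to the boundary
    (∀ τ ∈ closure RamanujanLevelFour.cuspDomain,
      RamanujanLevelFour.F2 τ ≠ 0 ∧
      RamanujanLevelFour.F2 τ ^ 2 - RamanujanLevelFour.G2 τ ^ 2 ≠ 0 ∧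
      HasSum (RamanujanLevelFour.hyp32Term (1 / 2) (1 / 2) (1 / 2) 1 1
        (1 / RamanujanLevelFour.J4 τ)) (RamanujanLevelFour.F2 τ)) ∧
    -- the formula for 1/π, with absolute convergence inside the domain
    (∀ τ ∈ RamanujanLevelFour.cuspDomain,
      RamanujanLevelFour.G2 τ ≠ 0 ∧
      HasSum (RamanujanLevelFour.piTerm τ)
        (3 / (2 * (Real.pi : ℂ) * (τ.im : ℂ)) *
          (RamanujanLevelFour.F2 τ / RamanujanLevelFour.G2 τ))) ∧
    -- the formula for 1/π up to the boundary, where it may converge only conditionally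
    (∀ τ ∈ closure RamanujanLevelFour.cuspDomain, RamanujanLevelFour.J4 τ ≠ 1 →
      RamanujanLevelFour.G2 τ ≠ 0 ∧
      Filter.Tendsto
        (fun N : ℕ => ∑ n ∈ Finset.range N, RamanujanLevelFour.piTerm τ n) Filter.atTop
        (nhds (3 / (2 * (Real.pi : ℂ) * (τ.im : ℂ)) *
          (RamanujanLevelFour.F2 τ / RamanujanLevelFour.G2 τ)))) := by
  open RamanujanLevelFour in
  refine ⟨fun τ hτ => mem_cuspDomain_of_one_le_im hτ, fun τ hτ => ⟨F2_ne_zero τ,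
    F2_sq_sub_G2_sq_ne_zero τ, ?_⟩, fun τ hτ => ?_, fun τ hτ hJ =>
    ⟨G2_ne_zero_of_J4_ne_one hJ, tendsto_sum_piTerm hτ hJ⟩⟩
  · rw [one_div_J4, ← hyp_invJ_of_mem_closure hτ]
    exact (hasSum_hyp_zero (norm_invJ_le_of_mem_closure hτ)).congr_fun
      fun n => hyp32Term_half _ n
  · have hG := G2_ne_zero_of_J4_ne_one (J4_ne_one_of_mem_cuspDomain hτ)
    exact ⟨hG, hasSum_piTerm hτ hG⟩
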